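/- **Setting.** Fix a signature of atomic concepts $A$ (unary), relations $R$ of given arities (roles, when binary), attributes $U$ relating $n$-tuples of objects to values (predicates of arity $n+1$; $n=1$: concept attributes, $n=2$: role attributes) and value-domains $T$ (unary), and an infinite universe $\Delta$. An instance is a set of facts over the signature with arguments in $\Delta$. A database $D$ is a finite instance together with two distinct constants $0,1\in\Delta$; besides its relations it offers the predicates $Zero=\{0\}$, $One=\{1\}$ and $Neq=\{(a,b): a\ne b\}$ on its domain $dom(D)$ (the elements occurring in $D$, and $0,1$). Its $N$-numerical extension $D_N$ additionally has fresh numbers $0,\dots,N$ in its domain (on which $Neq$ is extended accordingly) and the predicates $Num=\{1,\dots,N\}$, $Succ$ and $<$ on $\{0,\dots,N\}$. A Boolean conjunctive query (CQ) $q$ is a finite conjunction of atoms over the signature, with existentially quantified variables and constants of $\Delta$. **DL-Lite.** Basic relation expressions are $G::=R\mid\delta(U)$, where $\delta(U)$ is the set of object tuples to which $U$ assigns a value. Basic concepts are $B::=A\mid\exists i{:}G$ (projection of $G$ on component $i$; for a role $P$ these are $\exists P$ and $\exists P^-$). Basic value-domains are $E::=T\mid\rho(U)$ (range of $U$). General value-domains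 are $F::=\top_D\mid E$, general relation expressions $H::=G\mid\delta_F(U)$ (tuples to which $U$ assigns a value in $F$), and general concepts $$C::=\top_C\mid B\mid\exists i{:}G.(j{:}C)\mid\exists i{:}\delta_F(U),$$ where $\exists i{:}G.(j{:}C)$, $i\neq j$, is the set of $i$-th components of tuples of $G$ whose $j$-th component is in $C$ (for roles: $\exists P.C$, $\exists P^-.C$). The positive assertions are $$B_1\sqcap\dots\sqcap B_n\sqsubseteq C\ (n\ge1),\quad E_1\sqcap\dots\sqcap E_n\sqsubseteq F\ (n\ge1),\quad G[i_1,\dots,i_k]\sqsubseteq H[j_1,\dots,j_k]\ (k\ge1,\text{ distinct components on each side}),\quad U\sqsubseteq U'.$$ The negative ones are the corresponding disjointness assertions (conjunctions allowed on the left) and functionality assertions for components of relation expressions and for attributes. A TBox is $\Sigma=(\Sigma^-,\Sigma^+)$ with finite sets $\Sigma^-$ of negative and $\Sigma^+$ of positive assertions. * *DLR-Lite*$_{\mathcal F,\sqcap}$: no attributes, value-domains or qualified existentials, $C=B$; concept assertions and functionality assertions, no relation assertions. * *DLR-Lite*$_{\mathcal R,\sqcap}$: likewise, but with relation assertions and without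 functionality assertions. * *DLR-Lite*$^+_{\mathcal A,\sqcap}$: all assertions, where a functional relation or attribute is neither on the right of an inclusion between relations or attributes nor qualified. * *DL-Lite*$_{\mathcal F,\sqcap}$, *DL-Lite*$_{\mathcal R,\sqcap}$, *DL-Lite*$^+_{\mathcal A,\sqcap}$: the same with all relations binary, all attributes concept or role attributes, and $k=2$ (i.e. role inclusions between possibly inverted roles). $(D,\Sigma^+)\models q$ means that $q$ holds in every (possibly infinite) instance $B\supseteq D$ that satisfies all assertions in $\Sigma^+$. A nonrecursive Datalog program is a finite set of safe rules (every head variable occurs in the body), without negation and possibly with constants from $\Delta$, whose predicate dependency graph is acyclic; it has a distinguished propositional predicate $goal$. $D\models P$ (resp. $D_N\models P$) means that $goal$ is derivable by $P$ from the facts of $D$ (resp. $D_N$). "$P$ has arity at most $n$" means that all predicate symbols occurring in $P$, except those occurring in $q$, have arity at most $n$. Let $|\Sigma^+|,|q|\ge 1$ be the sizes (numbers of symbols), and $a$ the maximum arity of a predicate symbol occurring in $\Sigma^+$. **Theorem.** For each of the six variants *DL-Lite*$_{\mathcal F,\sqcap}$, *DL-Lite*$_{\mathcal R,\sqcap}$,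 *DL-Lite*$^+_{\mathcal A,\sqcap}$, *DLR-Lite*$_{\mathcal F,\sqcap}$, *DLR-Lite*$_{\mathcal R,\sqcap}$, *DLR-Lite*$^+_{\mathcal A,\sqcap}$ there are a polynomial $\gamma$ with $\gamma(m,n)\ge\max(m,n)$ and a constant $c$ such that for every TBox $\Sigma=(\Sigma^-,\Sigma^+)$ of the variant and every CQ $q$: 1. there is a nonrecursive Datalog program $P$ of arity at most $\max(a+1,3)$ such that for every $N\ge\gamma(|\Sigma^+|,|q|)$ and every database $D$: $(D,\Sigma^+)\models q$ if and only if $D_N\models P$; 2. there is a nonrecursive Datalog program $P$ of arity at most $c\cdot\max(a+1,3)\cdot\lfloor\log_2(|\Sigma^+|+|q|)\rfloor$ such that for every database $D$: $(D,\Sigma^+)\models q$ if and only if $D\models P$. -/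

import Mathlib

universe u w

/-! ### Relational vocabulary: terms, atoms, facts, Boolean conjunctive queries -/

/-- A term: a variable (variables are numbered) or a constant from `K`. -/
inductive Term (K : Type w) where
  | var (n : ℕ)
  | const (c : K)

/-- Value of a term under an assignment `h` of the variables and a reading `ι` of the constants. -/
def Term.eval {K : Type w} {Δ : Type w} (ι : K → Δ) (h : ℕ → Δ) : Term K → Δ
  | .var n => h n
  | .const c => ι c

/-- An atom `p(x₁,…,xₙ)` over predicate symbols with arities `ar` and arguments from `X`.
With `X` a set of domain elements this is a fact, with `X` a set of terms a query atom. -/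
structure Atom {P : Type u} (ar : P → ℕ) (X : Type w) where
  pred : P
  args : Fin (ar pred) → X

def Atom.map {P : Type u} {ar : P → ℕ} {X Y : Type w} (f : X → Y) (A : Atom ar X) : Atom ar Y :=
  ⟨A.pred, fun i => f (A.args i)⟩

/-- A relational instance (a possibly infinite database): a set of facts. -/
abbrev Instance {P : Type u} (ar : P → ℕ) (Δ : Type w) := Set (Atom ar Δ)

/-- A Boolean conjunctive query: a finite conjunction of atoms over variables and constants, all
variables being existentially quantified. -/
abbrev BCQ {P : Type u} (ar : P → ℕ) (K : Type w) := List (Atom ar (Term K))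

/-- `B ⊨ q`: there is a homomorphism from `q` to `B` (constants are mapped to themselves). -/
def BCQ.HoldsIn {P : Type u} {ar : P → ℕ} {Δ : Type w} (q : BCQ ar Δ) (B : Instance ar Δ) : Prop :=
  ∃ h : ℕ → Δ, ∀ A ∈ q, A.map (Term.eval id h) ∈ B

/-- Size `|q|`: the number of occurrences of predicate symbols and arguments, plus one. -/
def BCQ.size {P : Type u} {ar : P → ℕ} {K : Type w} (q : BCQ ar K) : ℕ :=
  1 + (q.map fun A => 1 + ar A.pred).sum

/-! ### Signatures and syntax of the DL-Lite family -/

/-- A DL signature: atomic concepts, relations (roles, if binary) of given arities, attributes, and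
value-domains (datatypes). An attribute `U` with `attrArity U = n` relates `n`-tuples of objects to
values: for `n = 1` it is a concept attribute, for `n = 2` a role attribute. -/
structure Signature where
  Concept : Type u
  Rel : Type u
  relArity : Rel → ℕ
  Attr : Type u
  attrArity : Attr → ℕ
  DType : Type u

/-- The predicate symbols of a signature. -/
inductive Signature.Sym (S : Signature.{u}) : Type u where
  | concept (A : S.Concept)
  | rel (R : S.Rel)
  | attr (U : S.Attr)
  | dtype (T : S.DType)

def Signature.arity (S : Signature.{u}) : S.Sym → ℕ
  | .concept _ => 1
  | .rel R => S.relArity R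
  | .attr U => S.attrArity U + 1
  | .dtype _ => 1

section Language
variable (S : Signature.{u})

/-- Basic relation expressions: `R`, and the domain `δ(U)` of an attribute. -/
inductive BasicRel where
  | rel (R : S.Rel)
  | dom (U : S.Attr)

def BasicRel.arity {S : Signature.{u}} : BasicRel S → ℕ
  | .rel R => S.relArity R
  | .dom U => S.attrArity U

/-- Basic concepts: `A`, and `∃i:G`, the projection of `G` on its `i`-th component.
For a role `P` the two projections are `∃P` and `∃P⁻`; for a concept attribute `U` the only
projection of `δ(U)` is the concept `δ(U)` itself; for a role attribute `U` the projections are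
`∃δ(U)` and `∃δ(U)⁻`. -/
inductive BasicConcept where
  | atomic (A : S.Concept)
  | proj (G : BasicRel S) (i : Fin G.arity)

/-- Basic value-domains: `T`, and the range `ρ(U)` of an attribute. -/
inductive BasicValue where
  | dtype (T : S.DType)
  | range (U : S.Attr)

/-- General (positive) value-domains: `⊤_D` and basic value-domains. -/
inductive GenValue where
  | top
  | basic (E : BasicValue S)

/-- General (positive) concepts: `⊤_C`, basic concepts, qualified existentials, and qualified
attribute domains. `some G i j C` is the set of all `i`-th components of tuples of `G` whose `j`-th
component is in `C`; for a role `P` these are `∃P.C` and `∃P⁻.C`.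
`attrSome U i F` is the projection on the `i`-th component of `δ_F(U)`, the set of tuples that `U`
relates to some value in `F`. -/
inductive GenConcept where
  | top
  | basic (B : BasicConcept S)
  | some (G : BasicRel S) (i j : Fin G.arity) (hij : i ≠ j) (C : GenConcept)
  | attrSome (U : S.Attr) (i : Fin (S.attrArity U)) (F : GenValue S)

/-- General (positive) relation expressions: `R`, `δ(U)` and the qualified domain `δ_F(U)`. -/
inductive GenRel where
  | basic (G : BasicRel S)
  | domQ (U : S.Attr) (F : GenValue S)

def GenRel.arity {S : Signature.{u}} : GenRel S → ℕ
  | .basic G => G.arity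
  | .domQ U _ => S.attrArity U

/-- Positive inclusion assertions.
* `concept B Bs C` is `B ⊓ B₁ ⊓ … ⊓ Bₙ ⊑ C` where `Bs = [B₁,…,Bₙ]`;
* `value E Es F` is the same for value-domains;
* `rel G H k i j` is `G[i₁,…,i_k] ⊑ H[j₁,…,j_k]`, the components on each side being distinct.
  For roles and `k = 2` these are the role inclusions, `P[1,2]` being `P` and `P[2,1]` being `P⁻`;
* `attr U U'` is `U ⊑ U'`. -/
inductive PosAxiom where
  | concept (B : BasicConcept S) (Bs : List (BasicConcept S)) (C : GenConcept S)
  | value (E : BasicValue S) (Es : List (BasicValue S)) (F : GenValue S)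
  | rel (G : BasicRel S) (H : GenRel S) (k : ℕ) (i : Fin k ↪ Fin G.arity) (j : Fin k ↪ Fin H.arity)
  | attr (U U' : S.Attr) (h : S.attrArity U = S.attrArity U')

/-- Negative constraints: disjointness assertions and functionality (key) assertions.
`functRel G i` is `(funct i:G)`; for a role `P` these are `(funct P)` and `(funct P⁻)`. -/
inductive NegAxiom where
  | concept (B : BasicConcept S) (Bs : List (BasicConcept S)) (B' : BasicConcept S)
  | value (E : BasicValue S) (Es : List (BasicValue S)) (E' : BasicValue S)
  | rel (G H : BasicRel S) (k : ℕ) (i : Fin k ↪ Fin G.arity) (j : Fin k ↪ Fin H.arity)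
  | attr (U U' : S.Attr) (h : S.attrArity U = S.attrArity U')
  | functRel (G : BasicRel S) (i : Fin G.arity)
  | functAttr (U : S.Attr)

/-- A TBox `Σ = (Σ⁻, Σ⁺)`. -/
structure TBox where
  neg : List (NegAxiom S)
  pos : List (PosAxiom S)

end Language

/-! ### Semantics -/

section Semantics
variable {S : Signature.{u}} {Δ : Type w} (I : Instance S.arity Δ)

/-- `U(x₁,…,xₙ,v)` holds in `I`. -/
def AttrHolds (U : S.Attr) (t : Fin (S.attrArity U) → Δ) (v : Δ) : Prop :=
  (⟨.attr U, Fin.snoc (α := fun _ => Δ) t v⟩ : Atom S.arity Δ) ∈ I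

def BasicRel.ext : (G : BasicRel S) → Set (Fin G.arity → Δ)
  | .rel R => {t | (⟨.rel R, t⟩ : Atom S.arity Δ) ∈ I}
  | .dom U => {t | ∃ v, AttrHolds I U t v}

def BasicConcept.ext : BasicConcept S → Set Δ
  | .atomic A => {x | (⟨.concept A, fun _ => x⟩ : Atom S.arity Δ) ∈ I}
  | .proj G i => {x | ∃ t ∈ G.ext I, t i = x}

def BasicValue.ext : BasicValue S → Set Δ
  | .dtype T => {x | (⟨.dtype T, fun _ => x⟩ : Atom S.arity Δ) ∈ I}
  | .range U => {v | ∃ t, AttrHolds I U t v}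

def GenValue.ext : GenValue S → Set Δ
  | .top => Set.univ
  | .basic E => E.ext I

def GenConcept.ext : GenConcept S → Set Δ
  | .top => Set.univ
  | .basic B => B.ext I
  | .some G i j _ C => {x | ∃ t ∈ G.ext I, t i = x ∧ t j ∈ C.ext}
  | .attrSome U i F => {x | ∃ t v, AttrHolds I U t v ∧ t i = x ∧ v ∈ F.ext I}

def GenRel.ext : (H : GenRel S) → Set (Fin H.arity → Δ)
  | .basic G => G.ext I
  | .domQ U F => {t | ∃ v ∈ F.ext I, AttrHolds I U t v}

/-- The positive inclusion assertion is satisfied in `I`. -/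
def PosAxiom.Holds : PosAxiom S → Prop
  | .concept B Bs C => ∀ x, (∀ B' ∈ B :: Bs, x ∈ B'.ext I) → x ∈ C.ext I
  | .value E Es F => ∀ x, (∀ E' ∈ E :: Es, x ∈ E'.ext I) → x ∈ F.ext I
  | .rel G H _ i j => ∀ t ∈ G.ext I, ∃ t' ∈ H.ext I, ∀ l, t' (j l) = t (i l)
  | .attr U U' h => ∀ t v, AttrHolds I U t v → AttrHolds I U' (fun i => t (Fin.cast h.symm i)) v

/-- The negative constraint is satisfied in `I`. -/
def NegAxiom.Holds : NegAxiom S → Prop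
  | .concept B Bs B' => ∀ x, (∀ B'' ∈ B :: Bs, x ∈ B''.ext I) → x ∉ B'.ext I
  | .value E Es E' => ∀ x, (∀ E'' ∈ E :: Es, x ∈ E''.ext I) → x ∉ E'.ext I
  | .rel G H _ i j => ∀ t ∈ G.ext I, ¬ ∃ t' ∈ H.ext I, ∀ l, t' (j l) = t (i l)
  | .attr U U' h => ∀ t v, AttrHolds I U t v → ¬ AttrHolds I U' (fun i => t (Fin.cast h.symm i)) v
  | .functRel G i => ∀ t ∈ G.ext I, ∀ t' ∈ G.ext I, t i = t' i → t = t'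
  | .functAttr U => ∀ t v v', AttrHolds I U t v → AttrHolds I U t v' → v = v'

end Semantics

/-! ### The six variants -/

/-- `F`: functionality assertions, no relation inclusions. `R`: relation inclusions, no functionality
assertions. `A`: both, with attributes of concepts and relations, value-domains and qualified
existentials. -/
inductive Flavour where
  | F | R | A

/-- `⟨F, false⟩`, `⟨R, false⟩`, `⟨A, false⟩` are DL-Lite_{F,⊓}, DL-Lite_{R,⊓}, DL-Lite⁺_{A,⊓};
`⟨F, true⟩`, `⟨R, true⟩`, `⟨A, true⟩` are the versions DLR-Lite_{F,⊓}, DLR-Lite_{R,⊓},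
DLR-Lite⁺_{A,⊓} with relations of arbitrary arity. -/
structure Variant where
  flavour : Flavour
  nary : Bool

section Variants
variable {S : Signature.{u}}

/-- No attribute occurs. -/
def BasicRel.Plain : BasicRel S → Prop
  | .rel _ => True
  | .dom _ => False

def BasicConcept.Plain : BasicConcept S → Prop
  | .atomic _ => True
  | .proj G _ => G.Plain

/-- Unqualified and without attributes. -/
def GenConcept.Plain : GenConcept S → Prop
  | .basic B => B.Plain
  | _ => False

def GenRel.Plain : GenRel S → Prop
  | .basic G => G.Plain
  | .domQ _ _ => False

/-- The inclusion assertions of each variant. -/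
def PosAxiom.Allowed (v : Variant) : PosAxiom S → Prop
  | .concept B Bs C => v.flavour = .A ∨ ((∀ B' ∈ B :: Bs, B'.Plain) ∧ C.Plain)
  | .value _ _ _ => v.flavour = .A
  | .rel G H k _ _ => 0 < k ∧ (v.nary = false → k = 2) ∧
      (v.flavour = .A ∨ (v.flavour = .R ∧ G.Plain ∧ H.Plain))
  | .attr _ _ _ => v.flavour = .A

/-- The negative constraints of each variant. -/
def NegAxiom.Allowed (v : Variant) : NegAxiom S → Prop
  | .concept B Bs B' => v.flavour = .A ∨ ((∀ B'' ∈ B :: Bs, B''.Plain) ∧ B'.Plain)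
  | .value _ _ _ => v.flavour = .A
  | .rel G H k _ _ => 0 < k ∧ (v.nary = false → k = 2) ∧
      (v.flavour = .A ∨ (v.flavour = .R ∧ G.Plain ∧ H.Plain))
  | .attr _ _ _ => v.flavour = .A
  | .functRel G _ => v.flavour = .A ∨ (v.flavour = .F ∧ G.Plain)
  | .functAttr _ => v.flavour = .A

/-- `G` occurs in a qualified existential in `C`. -/
def GenConcept.Qualifies (G : BasicRel S) : GenConcept S → Prop
  | .top => False
  | .basic _ => False
  | .some G' _ _ _ C => G' = G ∨ C.Qualifies G
  | .attrSome U _ F => G = .dom U ∧ F ≠ .top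

/-- The attribute `U` occurs in a qualified domain in `C`. -/
def GenConcept.QualifiesAttr (U : S.Attr) : GenConcept S → Prop
  | .top => False
  | .basic _ => False
  | .some _ _ _ _ C => C.QualifiesAttr U
  | .attrSome U' _ F => U' = U ∧ F ≠ .top

/-- The assertion specializes `G`: `G` is on the right of a relation inclusion or is qualified. -/
def PosAxiom.SpecializesRel (G : BasicRel S) : PosAxiom S → Prop
  | .concept _ _ C => C.Qualifies G
  | .value _ _ _ => False
  | .rel _ (.basic G') _ _ _ => G' = G
  | .rel _ (.domQ U _) _ _ _ => G = .dom U
  | .attr _ _ _ => False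

/-- The assertion specializes `U`: `U` is on the right of an attribute inclusion or is qualified. -/
def PosAxiom.SpecializesAttr (U : S.Attr) : PosAxiom S → Prop
  | .concept _ _ C => C.QualifiesAttr U
  | .value _ _ _ => False
  | .rel _ (.basic _) _ _ _ => False
  | .rel _ (.domQ U' F) _ _ _ => U' = U ∧ F ≠ .top
  | .attr _ U' _ => U' = U

/-- `T` is a TBox of the variant `v`. In the variants without n-ary relations all relations are
binary, and the attributes are concept attributes and role attributes. In the `A` variants, functional
relations and attributes must not be specialized. -/
structure Variant.Admits (v : Variant) (T : TBox S) : Prop where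
  relArity : v.nary = false → ∀ R, S.relArity R = 2
  attrArity : v.nary = false → ∀ U, S.attrArity U = 1 ∨ S.attrArity U = 2
  pos : ∀ σ ∈ T.pos, σ.Allowed v
  neg : ∀ σ ∈ T.neg, σ.Allowed v
  functRel : ∀ G i, NegAxiom.functRel G i ∈ T.neg → ∀ σ ∈ T.pos, ¬ σ.SpecializesRel G
  functAttr : ∀ U, NegAxiom.functAttr U ∈ T.neg → ∀ σ ∈ T.pos, ¬ σ.SpecializesAttr U

end Variants

/-! ### Predicate symbols and size of the positive part -/

section Size
variable {S : Signature.{u}}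

def BasicRel.sym : BasicRel S → S.Sym
  | .rel R => .rel R
  | .dom U => .attr U

def BasicConcept.sym : BasicConcept S → S.Sym
  | .atomic A => .concept A
  | .proj G _ => G.sym

def BasicValue.sym : BasicValue S → S.Sym
  | .dtype T => .dtype T
  | .range U => .attr U

/-- The list of occurrences of predicate symbols. -/
def GenValue.syms : GenValue S → List S.Sym
  | .top => []
  | .basic E => [E.sym]

def GenConcept.syms : GenConcept S → List S.Sym
  | .top => []
  | .basic B => [B.sym]
  | .some G _ _ _ C => G.sym :: C.syms
  | .attrSome U _ F => .attr U :: F.syms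

def GenRel.syms : GenRel S → List S.Sym
  | .basic G => [G.sym]
  | .domQ U F => .attr U :: F.syms

def PosAxiom.syms : PosAxiom S → List S.Sym
  | .concept B Bs C => (B :: Bs).map BasicConcept.sym ++ C.syms
  | .value E Es F => (E :: Es).map BasicValue.sym ++ F.syms
  | .rel G H _ _ _ => G.sym :: H.syms
  | .attr U U' _ => [.attr U, .attr U']

/-- Number of symbols of an assertion, counting one for each inclusion sign, each occurrence of a
predicate symbol and each argument position of it. -/
def PosAxiom.size (σ : PosAxiom S) : ℕ :=
  1 + (σ.syms.map fun p => 1 + S.arity p).sum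

/-- The size `|Σ⁺|`. -/
def posSize (Sp : List (PosAxiom S)) : ℕ :=
  1 + (Sp.map PosAxiom.size).sum

/-- The maximum arity of a predicate symbol occurring in `Σ⁺` (`0` if there is none). -/
def posArity (Sp : List (PosAxiom S)) : ℕ :=
  ((Sp.flatMap PosAxiom.syms).map S.arity).foldr max 0

end Size

/-! ### Databases and certain answers -/

/-- A database over the (infinite) universe `Δ`: a finite set of facts, with two distinct
distinguished constants `0` and `1`. -/
structure Database {P : Type u} (ar : P → ℕ) (Δ : Type w) where
  facts : Instance ar Δ
  finite : facts.Finite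
  zero : Δ
  one : Δ
  zero_ne_one : zero ≠ one

/-- `(D, Σ⁺) ⊨ q`: the query holds in every (possibly infinite) instance that contains `D` and
satisfies `Σ⁺`. -/
def CertainlyHolds {S : Signature.{u}} {Δ : Type w} (D : Database S.arity Δ)
    (Sp : List (PosAxiom S)) (q : BCQ S.arity Δ) : Prop :=
  ∀ B : Instance S.arity Δ, D.facts ⊆ B → (∀ σ ∈ Sp, σ.Holds B) → q.HoldsIn B

section DatabasePredicates
variable {P : Type u} {ar : P → ℕ} {Δ : Type w}

/-- The predicates available in a database: its relations, `Zero`, `One` and `Neq`. -/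
inductive DBSym (P : Type u) where
  | rel (p : P)
  | zero
  | one
  | neq

def DBSym.arity (ar : P → ℕ) : DBSym P → ℕ
  | .rel p => ar p
  | .zero => 1
  | .one => 1
  | .neq => 2

/-- The predicates available in a numerical database: additionally `Num`, `Succ` and `<`. -/
inductive NumSym (P : Type u) where
  | db (p : DBSym P)
  | num
  | succ
  | lt

def NumSym.arity (ar : P → ℕ) : NumSym P → ℕ
  | .db p => p.arity ar
  | .num => 1
  | .succ => 2
  | .lt => 2

/-- `dom(D)`: the elements occurring in a fact, and `0` and `1`. -/
def Database.dom (D : Database ar Δ) : Set Δ :=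
  {x | (∃ f ∈ D.facts, ∃ i, f.args i = x) ∨ x = D.zero ∨ x = D.one}

/-- The facts of `D` over all its predicates. -/
inductive Database.Full (D : Database ar Δ) : Atom (DBSym.arity ar) Δ → Prop
  | rel (f : Atom ar Δ) (hf : f ∈ D.facts) : D.Full ⟨.rel f.pred, f.args⟩
  | zero : D.Full ⟨.zero, ![D.zero]⟩
  | one : D.Full ⟨.one, ![D.one]⟩
  | neq (x y : Δ) (hx : x ∈ D.dom) (hy : y ∈ D.dom) (h : x ≠ y) : D.Full ⟨.neq, ![x, y]⟩

/-- The total domain of the `N`-numerical extension: `dom(D)` and a fresh copy of `0,…,N`. -/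
def Database.numDom (D : Database ar Δ) (N : ℕ) : Set (Δ ⊕ Fin (N + 1)) :=
  {z | ∀ x, z = Sum.inl x → x ∈ D.dom}

/-- The facts of the `N`-numerical extension `D_N`. -/
inductive Database.NumFull (D : Database ar Δ) (N : ℕ) :
    Atom (NumSym.arity ar) (Δ ⊕ Fin (N + 1)) → Prop
  | rel (f : Atom ar Δ) (hf : f ∈ D.facts) :
      D.NumFull N ⟨.db (.rel f.pred), fun i => Sum.inl (f.args i)⟩
  | zero : D.NumFull N ⟨.db .zero, ![Sum.inl D.zero]⟩
  | one : D.NumFull N ⟨.db .one, ![Sum.inl D.one]⟩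
  | neq (x y : Δ ⊕ Fin (N + 1)) (hx : x ∈ D.numDom N) (hy : y ∈ D.numDom N) (h : x ≠ y) :
      D.NumFull N ⟨.db .neq, ![x, y]⟩
  | num (m : Fin (N + 1)) (h : 1 ≤ (m : ℕ)) : D.NumFull N ⟨.num, ![Sum.inr m]⟩
  | succ (m n : Fin (N + 1)) (h : (n : ℕ) = m + 1) : D.NumFull N ⟨.succ, ![Sum.inr m, Sum.inr n]⟩
  | lt (m n : Fin (N + 1)) (h : m < n) : D.NumFull N ⟨.lt, ![Sum.inr m, Sum.inr n]⟩

end DatabasePredicates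

/-! ### Nonrecursive Datalog -/

/-- Intensional predicate symbols: a name and an arity. -/
structure IDB where
  name : ℕ
  arity : ℕ

/-- The propositional goal predicate. -/
def IDB.goal : IDB := ⟨0, 0⟩

/-- Predicates of a Datalog program over extensional predicates `E`. -/
inductive DPred (E : Type u) where
  | edb (e : E)
  | idb (p : IDB)

def DPred.arity {E : Type u} (ar : E → ℕ) : DPred E → ℕ
  | .edb e => ar e
  | .idb p => p.arity

section Datalog
variable {E : Type u} (ar : E → ℕ) (K : Type w)

/-- A Datalog rule `head :- body`, with constants from `K`. -/
structure Rule where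
  head : Atom IDB.arity (Term K)
  body : List (Atom (DPred.arity ar) (Term K))

/-- A Datalog program: a finite set of rules. -/
abbrev Program := List (Rule ar K)

variable {ar K}

/-- Every variable of the head occurs in the body. -/
def Rule.Safe (r : Rule ar K) : Prop :=
  ∀ i n, r.head.args i = .var n → ∃ A ∈ r.body, ∃ j, A.args j = .var n

/-- `p` depends directly on `p'`. -/
def Program.DependsOn (P : Program ar K) (p p' : IDB) : Prop :=
  ∃ r ∈ P, r.head.pred = p ∧ ∃ A ∈ r.body, A.pred = .idb p'

/-- A (safe) nonrecursive Datalog program: the dependency graph of its predicates is acyclic. -/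
structure Program.IsNonrecursive (P : Program ar K) : Prop where
  safe : ∀ r ∈ P, r.Safe
  acyclic : ∀ p, ¬ Relation.TransGen P.DependsOn p p

/-- All predicate symbols occurring in `P`, except those in `X`, have arity at most `n`. -/
def Program.ArityLE (P : Program ar K) (X : Set E) (n : ℕ) : Prop :=
  ∀ r ∈ P, r.head.pred.arity ≤ n ∧
    ∀ A ∈ r.body, A.pred.arity ar ≤ n ∨ ∃ e ∈ X, A.pred = .edb e

/-- The facts derivable from the extensional facts `F` by `P`, `ι` giving the value of constants. -/
inductive Program.Derives {Δ : Type w} (P : Program ar K) (ι : K → Δ) (F : Atom ar Δ → Prop) :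
    Atom (DPred.arity ar) Δ → Prop
  | edb (f : Atom ar Δ) (hf : F f) : P.Derives ι F ⟨.edb f.pred, f.args⟩
  | rule (r : Rule ar K) (hr : r ∈ P) (h : ℕ → Δ)
      (hb : ∀ A ∈ r.body, P.Derives ι F (A.map (Term.eval ι h))) :
      P.Derives ι F ⟨.idb r.head.pred, fun i => (r.head.args i).eval ι h⟩

/-- The goal is derivable. -/
def Program.Accepts {Δ : Type w} (P : Program ar K) (ι : K → Δ) (F : Atom ar Δ → Prop) : Prop :=
  P.Derives ι F ⟨.idb IDB.goal, fun i => Fin.elim0 i⟩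

end Datalog

/-- `D ⊨ P`. -/
def Database.Models {Q : Type u} {ar : Q → ℕ} {Δ : Type w} (D : Database ar Δ)
    (P : Program (DBSym.arity ar) Δ) : Prop :=
  P.Accepts id D.Full

/-- `D_N ⊨ P`. -/
def Database.NumModels {Q : Type u} {ar : Q → ℕ} {Δ : Type w} (D : Database ar Δ) (N : ℕ)
    (P : Program (NumSym.arity ar) Δ) : Prop :=
  P.Accepts Sum.inl (D.NumFull N)

/-!
The theorem holds because query answering with the positive assertions is first-order rewritable:
for every `Σ⁺` and `q` there is a finite union of conjunctive queries that holds in a database `D`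
iff `(D, Σ⁺) ⊨ q` (`exists_rewriting_certainlyHolds`). One rule `goal :- q'` for each of these
queries `q'` makes up a nonrecursive program, whose predicates are the symbols of `Σ⁺` and `q` and
`goal`. The same program serves for both parts; it needs neither the numbers of `D_N` nor `Zero`,
`One` and `Neq`. The size of the program is not at issue here, only its arity.

Every positive assertion is equivalent to a tuple-generating dependency of one of two shapes
(`PosAxiom.exists_tgd`): either its body is a single atom with distinct variables, or it says that an
element `x` occurs at certain argument places, and `x` is the only variable shared with the head.
The Skolem chase of `D` with these dependencies is universal: `(D, Σ⁺) ⊨ q` iff `q` maps into it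
(`Entails.exists_hom_chase`, `entails_of_hom_chase`). Since the universe is fixed and models have to
live in it, the first direction needs an embedding of the chase into `Δ`, which exists because `Δ` is
infinite and there are only `|Δ|` Skolem terms.

The crucial point is that a fact of the chase depends on boundedly many facts of `D`
(`exists_support`). Dependencies with a single atom in the body do not increase the support. For the
others, all body facts contain the element `x`. If `x` is a null, they are all consequences of
the step that created `x`, so they share its support. If `x` is an element of `D`, the places at which
it occurs in the chase are determined by those at which it occurs in `D`, and one witness for each of
the finitely many relevant places suffices. Hence an entailed query is already entailed by a part of
`D` whose size has a bound depending on `Σ⁺` and `q` only, and there are only finitely many queries of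
bounded size (`exists_rewriting`).
-/

/-! ### Tuple-generating dependencies -/

/-- The atom with `f` applied to its arguments, as `Atom.map`, across universes. -/
def Atom.subst {P : Type u} {ar : P → ℕ} {X : Type*} {Y : Type*} (f : X → Y) (A : Atom ar X) :
    Atom ar Y :=
  ⟨A.pred, fun i => f (A.args i)⟩

/-- A place `(p, i)`: the `i`-th argument position of the predicate symbol `p`. -/
abbrev Place {P : Type u} (ar : P → ℕ) := Σ p : P, Fin (ar p)

/-- `x` occurs in `I` at the place `s`. The extensions of basic concepts and of basic value-domains
are all of this form. -/
def Place.At {P : Type u} {ar : P → ℕ} {X : Type w} (s : Place ar) (I : Instance ar X) (x : X) :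
    Prop :=
  ∃ t : Fin (ar s.1) → X, (⟨s.1, t⟩ : Atom ar X) ∈ I ∧ t s.2 = x

/-- Tuple-generating dependencies of the two shapes to which all positive assertions reduce.
* `conj s ss head`: if `x` occurs at all the places `s :: ss`, then the head holds; its variables are
  `none`, standing for `x`, and existential variables `some v`.
* `lin p head`: if `p(t)`, then the head holds; its variables are `Sum.inl i`, standing for `t i`, and
  existential variables `Sum.inr v`. -/
inductive TGD {P : Type u} (ar : P → ℕ) where
  | conj (s : Place ar) (ss : List (Place ar)) (head : List (Atom ar (Option ℕ)))
  | lin (p : P) (head : List (Atom ar (Fin (ar p) ⊕ ℕ)))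

section TGD
variable {P : Type u} {ar : P → ℕ} {X : Type w}

/-- The dependency is satisfied in `I`. -/
def TGD.Holds (I : Instance ar X) : TGD ar → Prop
  | .conj s ss head => ∀ x, (∀ s' ∈ s :: ss, s'.At I x) →
      ∃ h : ℕ → X, ∀ A ∈ head, A.subst (fun o => o.elim x h) ∈ I
  | .lin p head => ∀ t : Fin (ar p) → X, (⟨p, t⟩ : Atom ar X) ∈ I →
      ∃ h : ℕ → X, ∀ A ∈ head, A.subst (Sum.elim t h) ∈ I

/-- All predicate symbols in the body of the dependency belong to `Q`. -/
def TGD.BodyIn (Q : Set P) : TGD ar → Prop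
  | .conj s ss _ => ∀ s' ∈ s :: ss, s'.1 ∈ Q
  | .lin p _ => p ∈ Q

/-- The property `φ` of an element of an instance is expressed by a conjunction of atoms, in which
the variable `none` stands for the element and the others are existentially quantified. -/
def Expressible (φ : Instance ar X → X → Prop) : Prop :=
  ∃ head : List (Atom ar (Option ℕ)),
    ∀ I x, φ I x ↔ ∃ h : ℕ → X, ∀ A ∈ head, A.subst (fun o => o.elim x h) ∈ I

theorem expressible_true : Expressible (fun (_ : Instance ar X) _ => True) :=
  ⟨[], fun _ x => by simpa using ⟨x⟩⟩

theorem Place.expressible_at (s : Place ar) : Expressible (X := X) (fun I x => s.At I x) := by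
  refine ⟨[⟨s.1, fun j => if j = s.2 then none else some j⟩], fun I x => ?_⟩
  simp only [List.mem_singleton, forall_eq]
  constructor
  · rintro ⟨t, ht, rfl⟩
    refine ⟨fun n => if hn : n < ar s.1 then t ⟨n, hn⟩ else t s.2, ?_⟩
    convert ht using 1
    simp only [Atom.subst, Atom.mk.injEq, heq_eq_eq, true_and]
    funext j
    by_cases hj : j = s.2 <;> simp [hj]
  · rintro ⟨h, hh⟩
    exact ⟨_, hh, by simp⟩

/-- Expressibility is preserved by passing along a `p`-fact from one place to a different one. The
variables of the formula for `ψ` are renamed apart from the arguments of the new atom. -/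
theorem Expressible.step {ψ : Instance ar X → X → Prop} (hψ : Expressible ψ) (p : P)
    {i j : Fin (ar p)} (hij : i ≠ j) :
    Expressible (fun I x => ∃ t : Fin (ar p) → X, (⟨p, t⟩ : Atom ar X) ∈ I ∧ t i = x ∧ ψ I (t j)) := by
  obtain ⟨head, hhead⟩ := hψ
  let e := finSumNatEquiv (ar p)
  refine ⟨⟨p, fun l => if l = i then none else some (e (.inl l))⟩ ::
    head.map (Atom.subst fun o => some (e (o.elim (.inl j) .inr))), fun I x => ?_⟩
  simp only [List.mem_cons, List.mem_map, forall_eq_or_imp, forall_exists_index, and_imp,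
    forall_apply_eq_imp_iff₂]
  constructor
  · rintro ⟨t, ht, rfl, h1⟩
    obtain ⟨h, hh⟩ := (hhead _ _).1 h1
    refine ⟨fun n => Sum.elim t h (e.symm n), ?_, fun A hA => ?_⟩
    · convert ht using 1
      simp only [Atom.subst, Atom.mk.injEq, heq_eq_eq, true_and]
      funext l
      by_cases hl : l = i <;> simp [hl]
    · convert hh A hA using 1
      simp only [Atom.subst, Atom.mk.injEq, heq_eq_eq, true_and]
      funext l
      cases A.args l <;> simp
  · rintro ⟨h, h1, h2⟩
    refine ⟨_, h1, by simp, (hhead _ _).2 ⟨fun v => h (e (.inr v)), fun A hA => ?_⟩⟩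
    convert h2 A hA using 1
    simp only [Atom.subst, Atom.mk.injEq, heq_eq_eq, true_and]
    funext l
    cases A.args l <;> simp [hij.symm]

/-- An inclusion between projections, with an expressible condition on the right-hand tuple, is
equivalent to a linear dependency. -/
theorem exists_lin_iff_inclusion (p p' : P) {k : ℕ} (i : Fin k → Fin (ar p))
    (j : Fin k ↪ Fin (ar p')) {φ : Instance ar X → (Fin (ar p') → X) → Prop}
    (hφ : ∃ extra : List (Atom ar (Fin (ar p') ⊕ ℕ)), ∀ I t', φ I t' ↔
      ∃ h : ℕ → X, ∀ A ∈ extra, A.subst (Sum.elim t' h) ∈ I) :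
    ∃ head, ∀ I : Instance ar X, (TGD.lin p head).Holds I ↔
      ∀ t : Fin (ar p) → X, (⟨p, t⟩ : Atom ar X) ∈ I →
        ∃ t' : Fin (ar p') → X, (⟨p', t'⟩ : Atom ar X) ∈ I ∧ (∀ l, t' (j l) = t (i l)) ∧ φ I t' := by
  classical
  obtain ⟨extra, hextra⟩ := hφ
  let e := finSumNatEquiv (ar p')
  let τ : Fin (ar p') → Fin (ar p) ⊕ ℕ := fun m =>
    if hm : ∃ l, j l = m then .inl (i hm.choose) else .inr (e (.inl m))
  have hτ : ∀ l, τ (j l) = .inl (i l) := fun l => by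
    have hl : ∃ l', j l' = j l := ⟨l, rfl⟩
    simp only [τ, dif_pos hl, j.injective hl.choose_spec]
  refine ⟨⟨p', τ⟩ :: extra.map (Atom.subst (Sum.elim τ fun v => .inr (e (.inr v)))), fun I => ?_⟩
  simp only [TGD.Holds, List.mem_cons, List.mem_map, forall_eq_or_imp, forall_exists_index, and_imp,
    forall_apply_eq_imp_iff₂]
  refine forall₂_congr fun t ht => ?_
  constructor
  · rintro ⟨h, h1, h2⟩
    refine ⟨_, h1, fun l => by simp [hτ], (hextra _ _).2 ⟨fun v => h (e (.inr v)), fun A hA => ?_⟩⟩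
    convert h2 A hA using 1
    simp only [Atom.subst, Atom.mk.injEq, heq_eq_eq, true_and]
    funext l
    cases A.args l <;> simp
  · rintro ⟨t', h1, h2, h3⟩
    obtain ⟨h, hh⟩ := (hextra _ _).1 h3
    have ht' : ∀ m, Sum.elim t (fun n => Sum.elim t' h (e.symm n)) (τ m) = t' m := fun m => by
      by_cases hm : ∃ l, j l = m
      · obtain ⟨l, rfl⟩ := hm
        simp [hτ, h2]
      · simp [τ, hm]
    refine ⟨fun n => Sum.elim t' h (e.symm n), ?_, fun A hA => ?_⟩
    · simpa only [Atom.subst, ht'] using h1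
    · convert hh A hA using 1
      simp only [Atom.subst, Atom.mk.injEq, heq_eq_eq, true_and]
      funext l
      cases A.args l <;> simp [ht']

end TGD

/-! ### Positive assertions as dependencies -/

section Translation
variable {S : Signature.{u}} {Δ : Type w}

/-- The positions of the symbol of `G` that hold the components of the tuples of `G`. -/
def BasicRel.pos : (G : BasicRel S) → Fin G.arity ↪ Fin (S.arity G.sym)
  | .rel _ => .refl _
  | .dom _ => Fin.castSuccEmb

theorem BasicRel.mem_ext_iff (I : Instance S.arity Δ) (G : BasicRel S) (t : Fin G.arity → Δ) :
    t ∈ G.ext I ↔ ∃ s, (⟨G.sym, s⟩ : Atom S.arity Δ) ∈ I ∧ (fun i => s (G.pos i)) = t := by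
  cases G with
  | rel R => exact ⟨fun h => ⟨t, h, rfl⟩, by rintro ⟨s, h, rfl⟩; exact h⟩
  | dom U =>
    constructor
    · rintro ⟨v, h⟩
      exact ⟨_, h, funext fun i => Fin.snoc_castSucc (α := fun _ => Δ) v t i⟩
    · rintro ⟨s, h, rfl⟩
      refine ⟨s (Fin.last _), ?_⟩
      have hs : Fin.snoc (α := fun _ => Δ) (fun i => s (Fin.castSucc i)) (s (Fin.last _)) = s :=
        Fin.snoc_init_self (α := fun _ => Δ) s
      exact (congrArg (fun s' => (⟨.attr U, s'⟩ : Atom S.arity Δ) ∈ I) hs).mpr h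

theorem attrHolds_iff (I : Instance S.arity Δ) (U : S.Attr) (t : Fin (S.attrArity U) → Δ) (v : Δ) :
    AttrHolds I U t v ↔ ∃ s : Fin (S.attrArity U + 1) → Δ, (⟨.attr U, s⟩ : Atom S.arity Δ) ∈ I ∧
      (fun i => s i.castSucc) = t ∧ s (Fin.last _) = v := by
  constructor
  · intro h
    exact ⟨_, h, funext fun i => Fin.snoc_castSucc (α := fun _ => Δ) v t i,
      Fin.snoc_last (α := fun _ => Δ) v t⟩
  · rintro ⟨s, h, rfl, rfl⟩
    have hs : Fin.snoc (α := fun _ => Δ) (fun i => s (Fin.castSucc i)) (s (Fin.last _)) = s :=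
      Fin.snoc_init_self (α := fun _ => Δ) s
    exact (congrArg (fun s' => (⟨.attr U, s'⟩ : Atom S.arity Δ) ∈ I) hs).mpr h

/-- The place whose occurrences form the basic concept. -/
def BasicConcept.place : (B : BasicConcept S) → Place S.arity
  | .atomic A => ⟨.concept A, (0 : Fin 1)⟩
  | .proj G i => ⟨G.sym, G.pos i⟩

/-- The place whose occurrences form the basic value-domain. -/
def BasicValue.place : (E : BasicValue S) → Place S.arity
  | .dtype T => ⟨.dtype T, (0 : Fin 1)⟩
  | .range U => ⟨.attr U, Fin.last (S.attrArity U)⟩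

theorem mem_unary_iff (I : Instance S.arity Δ) (p : S.Sym) (hp : S.arity p = 1)
    (i : Fin (S.arity p)) (x : Δ) :
    (⟨p, fun _ => x⟩ : Atom S.arity Δ) ∈ I ↔ Place.At ⟨p, i⟩ I x := by
  have : Subsingleton (Fin (S.arity p)) := by rw [hp]; infer_instance
  constructor
  · exact fun h => ⟨_, h, rfl⟩
  · rintro ⟨t, ht, rfl⟩
    convert ht using 3 with j
    exact congrArg t (Subsingleton.elim _ _)

theorem BasicConcept.mem_ext_iff (I : Instance S.arity Δ) (B : BasicConcept S) (x : Δ) :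
    x ∈ B.ext I ↔ B.place.At I x := by
  cases B with
  | atomic A => exact mem_unary_iff I (.concept A) rfl _ x
  | proj G i =>
    simp only [BasicConcept.ext, Set.mem_ofPred_eq, BasicRel.mem_ext_iff, Place.At,
      BasicConcept.place]
    constructor
    · rintro ⟨_, ⟨s, hs, rfl⟩, rfl⟩
      exact ⟨s, hs, rfl⟩
    · rintro ⟨s, hs, rfl⟩
      exact ⟨_, ⟨s, hs, rfl⟩, rfl⟩

theorem BasicValue.mem_ext_iff (I : Instance S.arity Δ) (E : BasicValue S) (x : Δ) :
    x ∈ E.ext I ↔ E.place.At I x := by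
  cases E with
  | dtype T => exact mem_unary_iff I (.dtype T) rfl _ x
  | range U =>
    simp only [BasicValue.ext, Set.mem_ofPred_eq, attrHolds_iff, Place.At, BasicValue.place]
    constructor
    · rintro ⟨_, s, hs, rfl, rfl⟩
      exact ⟨s, hs, rfl⟩
    · rintro ⟨s, hs, rfl⟩
      exact ⟨_, s, hs, rfl, rfl⟩

theorem GenValue.expressible (F : GenValue S) :
    Expressible (fun (I : Instance S.arity Δ) x => x ∈ F.ext I) := by
  cases F with
  | top => exact expressible_true
  | basic E =>
    simp only [GenValue.ext, BasicValue.mem_ext_iff]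
    exact E.place.expressible_at

theorem GenConcept.expressible (C : GenConcept S) :
    Expressible (fun (I : Instance S.arity Δ) x => x ∈ C.ext I) := by
  induction C with
  | top => exact expressible_true
  | basic B =>
    simp only [GenConcept.ext, BasicConcept.mem_ext_iff]
    exact B.place.expressible_at
  | some G i j hij C ih =>
    obtain ⟨head, hh⟩ := ih.step G.sym (G.pos.injective.ne hij)
    refine ⟨head, fun I x => Iff.trans ?_ (hh I x)⟩
    simp only [GenConcept.ext, Set.mem_ofPred_eq, BasicRel.mem_ext_iff]
    constructor
    · rintro ⟨_, ⟨s, hs, rfl⟩, h1, h2⟩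
      exact ⟨s, hs, h1, h2⟩
    · rintro ⟨s, hs, h1, h2⟩
      exact ⟨_, ⟨s, hs, rfl⟩, h1, h2⟩
  | attrSome U i F =>
    obtain ⟨head, hh⟩ := (F.expressible (Δ := Δ)).step (.attr U) (Fin.castSucc_lt_last i).ne
    refine ⟨head, fun I x => Iff.trans ?_ (hh I x)⟩
    simp only [GenConcept.ext, Set.mem_ofPred_eq, attrHolds_iff]
    constructor
    · rintro ⟨_, _, ⟨s, hs, rfl, rfl⟩, h1, h2⟩
      exact ⟨s, hs, h1, h2⟩
    · rintro ⟨s, hs, h1, h2⟩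
      exact ⟨_, _, ⟨s, hs, rfl, rfl⟩, h1, h2⟩

/-- Every positive assertion is equivalent to a dependency of one of the two shapes. -/
theorem PosAxiom.exists_tgd (Δ : Type w) [Nonempty Δ] (σ : PosAxiom S) :
    ∃ ρ : TGD S.arity, ρ.BodyIn {p | p ∈ σ.syms} ∧
      ∀ I : Instance S.arity Δ, σ.Holds I ↔ ρ.Holds I := by
  cases σ with
  | concept B Bs C =>
    obtain ⟨head, hh⟩ := C.expressible (Δ := Δ)
    refine ⟨.conj B.place (Bs.map BasicConcept.place) head, ?_, fun I => ?_⟩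
    · have hs : ∀ B : BasicConcept S, B.place.1 = B.sym := by rintro (_ | _) <;> rfl
      simp only [TGD.BodyIn, ← List.map_cons, List.mem_map, forall_exists_index, and_imp,
        forall_apply_eq_imp_iff₂, hs, PosAxiom.syms, Set.mem_ofPred_eq, List.mem_append]
      exact fun B' hB' => .inl ⟨B', hB', rfl⟩
    · simp only [PosAxiom.Holds, TGD.Holds, ← List.map_cons, List.mem_map, forall_exists_index,
        and_imp, forall_apply_eq_imp_iff₂, BasicConcept.mem_ext_iff, hh]
  | value E Es F =>
    obtain ⟨head, hh⟩ := F.expressible (Δ := Δ)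
    refine ⟨.conj E.place (Es.map BasicValue.place) head, ?_, fun I => ?_⟩
    · have hs : ∀ E : BasicValue S, E.place.1 = E.sym := by rintro (_ | _) <;> rfl
      simp only [TGD.BodyIn, ← List.map_cons, List.mem_map, forall_exists_index, and_imp,
        forall_apply_eq_imp_iff₂, hs, PosAxiom.syms, Set.mem_ofPred_eq, List.mem_append]
      exact fun E' hE' => .inl ⟨E', hE', rfl⟩
    · simp only [PosAxiom.Holds, TGD.Holds, ← List.map_cons, List.mem_map, forall_exists_index,
        and_imp, forall_apply_eq_imp_iff₂, BasicValue.mem_ext_iff, hh]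
  | rel G H k i j =>
    cases H with
    | basic G' =>
      obtain ⟨head, hh⟩ := exists_lin_iff_inclusion (X := Δ) (ar := S.arity) G.sym G'.sym
        (fun l => G.pos (i l)) (j.trans G'.pos) (φ := fun _ _ => True) ⟨[], by simp⟩
      refine ⟨.lin G.sym head, by simp [TGD.BodyIn, PosAxiom.syms], fun I => Iff.trans ?_ (hh I).symm⟩
      simp only [PosAxiom.Holds, GenRel.ext, BasicRel.mem_ext_iff, and_true]
      constructor
      · intro H t ht
        obtain ⟨_, h', h⟩ := H _ ⟨t, ht, rfl⟩
        obtain ⟨t', ht', rfl⟩ := (BasicRel.mem_ext_iff I G' _).1 h'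
        exact ⟨t', ht', h⟩
      · rintro H _ ⟨t, ht, rfl⟩
        obtain ⟨t', ht', h⟩ := H t ht
        exact ⟨_, (BasicRel.mem_ext_iff I G' _).2 ⟨t', ht', rfl⟩, h⟩
    | domQ U F =>
      obtain ⟨hF, hhF⟩ := F.expressible (Δ := Δ)
      obtain ⟨head, hh⟩ := exists_lin_iff_inclusion (X := Δ) (ar := S.arity) G.sym (.attr U)
        (fun l => G.pos (i l)) (j.trans Fin.castSuccEmb)
        (φ := fun I t => t (Fin.last _) ∈ F.ext I)
        ⟨hF.map (Atom.subst fun o => o.elim (.inl (Fin.last _)) .inr), fun I t' => by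
          simp only [hhF, List.mem_map, forall_exists_index, and_imp, forall_apply_eq_imp_iff₂]
          refine exists_congr fun h => forall₂_congr fun A _ => ?_
          simp only [Atom.subst]
          have : ∀ o : Option ℕ, Sum.elim t' h (o.elim (.inl (Fin.last _)) .inr) =
              o.elim (t' (Fin.last _)) h := by rintro (_ | _) <;> rfl
          simp only [this]⟩
      refine ⟨.lin G.sym head, by simp [TGD.BodyIn, PosAxiom.syms], fun I => Iff.trans ?_ (hh I).symm⟩
      simp only [PosAxiom.Holds, GenRel.ext, BasicRel.mem_ext_iff, Set.mem_ofPred_eq]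
      constructor
      · intro H t ht
        obtain ⟨_, ⟨_, hv, h'⟩, h⟩ := H _ ⟨t, ht, rfl⟩
        obtain ⟨t', ht', rfl, rfl⟩ := (attrHolds_iff I U _ _).1 h'
        exact ⟨t', ht', h, hv⟩
      · rintro H _ ⟨t, ht, rfl⟩
        obtain ⟨t', ht', h, hv⟩ := H t ht
        exact ⟨_, ⟨_, hv, (attrHolds_iff I U _ _).2 ⟨t', ht', rfl, rfl⟩⟩, h⟩
  | attr U U' h =>
    let j : Fin (S.attrArity U + 1) ↪ Fin (S.attrArity U' + 1) := (finCongr (by rw [h])).toEmbedding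
    have hj : j (Fin.last _) = Fin.last _ := Fin.ext h
    obtain ⟨head, hh⟩ := exists_lin_iff_inclusion (X := Δ) (ar := S.arity) (.attr U) (.attr U') id
      j (φ := fun _ _ => True) ⟨[], by simp⟩
    refine ⟨.lin (.attr U) head, by simp [TGD.BodyIn, PosAxiom.syms],
      fun I => Iff.trans ?_ (hh I).symm⟩
    simp only [PosAxiom.Holds, attrHolds_iff, and_true]
    constructor
    · intro H t ht
      obtain ⟨t', ht', h1, h2⟩ := H _ _ ⟨t, ht, rfl, rfl⟩
      refine ⟨t', ht', fun l => ?_⟩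
      induction l using Fin.lastCases with
      | last => exact (congrArg t' hj).trans h2
      | cast l => exact congrFun h1 (Fin.cast h l)
    · rintro H _ _ ⟨t, ht, rfl, rfl⟩
      obtain ⟨t', ht', h'⟩ := H t ht
      exact ⟨t', ht', funext fun l => h' (Fin.cast h.symm l).castSucc,
        (congrArg t' hj).symm.trans (h' (Fin.last _))⟩

end Translation

/-! ### The chase -/

/-- Elements of the chase: those of `Δ`, and the Skolem terms `null r v n t`, which denote the value
of the existential variable `v` when the `r`-th dependency is applied to `t`. -/
inductive ChaseTerm (Δ : Type w) : Type w where
  | base (d : Δ)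
  | null (r v n : ℕ) (t : Fin n → ChaseTerm Δ)

open Cardinal in
/-- Over an infinite `Δ` the chase terms can be embedded into `Δ`, with a given finite set of
elements kept fixed. -/
theorem ChaseTerm.exists_injective {Δ : Type w} [Infinite Δ] {F : Set Δ} (hF : F.Finite) :
    ∃ e : ChaseTerm Δ → Δ, Function.Injective e ∧ ∀ d ∈ F, e (.base d) = d := by
  classical
  let ar : Δ ⊕ ℕ × ℕ × ℕ → ℕ := Sum.elim (fun _ => 0) fun a => a.2.2
  let toW : ChaseTerm Δ → WType fun a => Fin (ar a) := fun x => ChaseTerm.rec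
    (fun d => ⟨.inl d, Fin.elim0⟩) (fun r v n _ ih => ⟨.inr (r, v, n), ih⟩) x
  have htoW : Function.Injective toW := by
    intro x
    induction x with
    | base d =>
      rintro (d' | _) h
      · exact congrArg _ (Sum.inl.inj (WType.mk.inj h).1)
      · exact nomatch (WType.mk.inj h).1
    | null r v n t ih =>
      rintro (_ | ⟨r', v', n', t'⟩) h
      · exact nomatch (WType.mk.inj h).1
      · obtain ⟨h', h⟩ := WType.mk.inj h
        cases h'
        congr 1
        exact funext fun k => ih k (congrFun (eq_of_heq h) k)
  have hcard : #(ChaseTerm Δ) ≤ #(Fᶜ : Set Δ) := by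
    rw [mk_compl_of_infinite F (hF.lt_aleph0.trans_le (aleph0_le_mk Δ))]
    refine (mk_le_of_injective htoW).trans (WType.cardinalMk_le_max_aleph0_of_finite'.trans ?_)
    simp [add_eq_left (aleph0_le_mk Δ) (aleph0_le_mk Δ)]
  obtain ⟨emb⟩ := hcard
  refine ⟨fun x => if h : ∃ d ∈ F, x = .base d then h.choose else emb x, fun x y hxy => ?_,
    fun d hd => ?_⟩
  · by_cases hx : ∃ d ∈ F, x = .base d <;> by_cases hy : ∃ d ∈ F, y = .base d
    · simp only [dif_pos hx, dif_pos hy] at hxy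
      rw [hx.choose_spec.2, hy.choose_spec.2, hxy]
    · simp only [dif_pos hx, dif_neg hy] at hxy
      exact absurd (hxy ▸ hx.choose_spec.1) (emb y).2
    · simp only [dif_neg hx, dif_pos hy] at hxy
      exact absurd (hxy ▸ hy.choose_spec.1) (emb x).2
    · simp only [dif_neg hx, dif_neg hy] at hxy
      exact emb.injective (Subtype.ext hxy)
  · have h : ∃ d' ∈ F, ChaseTerm.base d = .base d' := ⟨d, hd, rfl⟩
    simp only [dif_pos h]
    exact (ChaseTerm.base.inj h.choose_spec.2).symm

section Chase
variable {P : Type u} {ar : P → ℕ} {Δ : Type w}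

/-- The facts of the Skolem chase of `D` with the dependencies `rs`. -/
inductive Chase (rs : List (TGD ar)) (D : Set (Atom ar Δ)) : Atom ar (ChaseTerm Δ) → Prop
  | base (f : Atom ar Δ) (hf : f ∈ D) : Chase rs D (f.map .base)
  | conj (r : ℕ) (s : Place ar) (ss : List (Place ar)) (head : List (Atom ar (Option ℕ)))
      (hr : rs[r]? = some (.conj s ss head)) (x : ChaseTerm Δ)
      (t : ∀ s : Place ar, Fin (ar s.1) → ChaseTerm Δ)
      (ht : ∀ s' ∈ s :: ss, Chase rs D ⟨s'.1, t s'⟩) (hx : ∀ s' ∈ s :: ss, t s' s'.2 = x)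
      (A : Atom ar (Option ℕ)) (hA : A ∈ head) :
      Chase rs D (A.subst fun o => o.elim x fun v => .null r v 1 fun _ => x)
  | lin (r : ℕ) (p : P) (head : List (Atom ar (Fin (ar p) ⊕ ℕ)))
      (hr : rs[r]? = some (.lin p head)) (t : Fin (ar p) → ChaseTerm Δ) (ht : Chase rs D ⟨p, t⟩)
      (A : Atom ar (Fin (ar p) ⊕ ℕ)) (hA : A ∈ head) :
      Chase rs D (A.subst (Sum.elim t fun v => .null r v (ar p) t))

/-- The chase as an instance. -/
def chase (rs : List (TGD ar)) (D : Set (Atom ar Δ)) : Instance ar (ChaseTerm Δ) :=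
  {f | Chase rs D f}

variable {rs : List (TGD ar)} {D D' : Set (Atom ar Δ)}

theorem base_mem_chase {f : Atom ar Δ} (hf : f ∈ D) : f.map .base ∈ chase rs D := Chase.base f hf

theorem conj_mem_chase {r : ℕ} {s : Place ar} {ss : List (Place ar)}
    {head : List (Atom ar (Option ℕ))} (hr : rs[r]? = some (.conj s ss head)) {x : ChaseTerm Δ}
    (hx : ∀ s' ∈ s :: ss, s'.At (chase rs D) x) {A : Atom ar (Option ℕ)} (hA : A ∈ head) :
    (A.subst fun o => o.elim x fun v => .null r v 1 fun _ => x) ∈ chase rs D := by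
  have hx' : ∀ s' : Place ar, ∃ t : Fin (ar s'.1) → ChaseTerm Δ, s' ∈ s :: ss →
      (⟨s'.1, t⟩ : Atom ar (ChaseTerm Δ)) ∈ chase rs D ∧ t s'.2 = x := fun s' => by
    by_cases hs' : s' ∈ s :: ss
    · obtain ⟨t, ht⟩ := hx s' hs'
      exact ⟨t, fun _ => ht⟩
    · exact ⟨fun _ => x, fun h => absurd h hs'⟩
  choose t ht using hx'
  exact .conj r s ss head hr x t (fun s' hs' => (ht s' hs').1) (fun s' hs' => (ht s' hs').2) A hA

theorem lin_mem_chase {r : ℕ} {p : P} {head : List (Atom ar (Fin (ar p) ⊕ ℕ))}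
    (hr : rs[r]? = some (.lin p head)) {t : Fin (ar p) → ChaseTerm Δ}
    (ht : (⟨p, t⟩ : Atom ar (ChaseTerm Δ)) ∈ chase rs D)
    {A : Atom ar (Fin (ar p) ⊕ ℕ)} (hA : A ∈ head) :
    A.subst (Sum.elim t fun v => .null r v (ar p) t) ∈ chase rs D :=
  .lin r p head hr t ht A hA

/-- Induction over the chase, with the body of a `conj` dependency described by `Place.At`. -/
theorem chase_induction {motive : Atom ar (ChaseTerm Δ) → Prop}
    (base : ∀ f ∈ D, motive (f.map .base))
    (conj : ∀ (r : ℕ) (s : Place ar) (ss : List (Place ar)) (head : List (Atom ar (Option ℕ))),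
      rs[r]? = some (.conj s ss head) → ∀ x : ChaseTerm Δ,
      (∀ s' ∈ s :: ss, s'.At {f | f ∈ chase rs D ∧ motive f} x) → ∀ A ∈ head,
        motive (A.subst fun o => o.elim x fun v => .null r v 1 fun _ => x))
    (lin : ∀ (r : ℕ) (p : P) (head : List (Atom ar (Fin (ar p) ⊕ ℕ))),
      rs[r]? = some (.lin p head) → ∀ t : Fin (ar p) → ChaseTerm Δ,
      ⟨p, t⟩ ∈ chase rs D → motive ⟨p, t⟩ → ∀ A ∈ head,
        motive (A.subst (Sum.elim t fun v => .null r v (ar p) t)))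
    {f : Atom ar (ChaseTerm Δ)} (hf : f ∈ chase rs D) : motive f := by
  have hf' : Chase rs D f := hf
  clear hf
  induction hf' with
  | base f hf => exact base f hf
  | conj r s ss head hr x t ht hx A hA ih =>
    exact conj r s ss head hr x (fun s' hs' => ⟨t s', ⟨ht s' hs', ih s' hs'⟩, hx s' hs'⟩) A hA
  | lin r p head hr t ht A hA ih => exact lin r p head hr t ht ih A hA

theorem Place.At.mono {X : Type w} {I J : Instance ar X} (h : I ⊆ J) {s : Place ar} {x : X} :
    s.At I x → s.At J x :=
  fun ⟨t, ht, hx⟩ => ⟨t, h ht, hx⟩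

theorem chase_mono (h : D ⊆ D') : chase rs D ⊆ chase rs D' := fun _ hf =>
  chase_induction (motive := (· ∈ chase rs D')) (fun _ hf => base_mem_chase (h hf))
    (fun _ _ _ _ hr _ hx _ hA =>
      conj_mem_chase hr (fun s' hs' => (hx s' hs').mono fun _ hg => hg.2) hA)
    (fun _ _ _ hr _ _ ht _ hA => lin_mem_chase hr ht hA) hf

theorem TGD.holds_chase {ρ : TGD ar} (hρ : ρ ∈ rs) : ρ.Holds (chase rs D) := by
  obtain ⟨r, hr⟩ := List.mem_iff_getElem?.1 hρ
  cases ρ with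
  | conj s ss head => exact fun x hx => ⟨_, fun A hA => conj_mem_chase hr hx hA⟩
  | lin p head => exact fun t ht => ⟨_, fun A hA => lin_mem_chase hr ht hA⟩

/-- The image of a model under an injective map is a model. -/
theorem TGD.Holds.image {X Y : Type w} {I : Instance ar X} {ρ : TGD ar} (h : ρ.Holds I) {e : X → Y}
    (he : Function.Injective e) : ρ.Holds (Atom.map e '' I) := by
  cases ρ with
  | conj s ss head =>
    intro y hy
    obtain ⟨_, ⟨⟨p, t⟩, -, hf⟩, rfl⟩ := hy s List.mem_cons_self
    cases hf
    obtain ⟨k, hk⟩ := h (t s.2) fun s' hs' => by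
      obtain ⟨_, ⟨⟨p', t'⟩, hf, hf'⟩, h'⟩ := hy s' hs'
      cases hf'
      exact ⟨t', hf, he h'⟩
    refine ⟨e ∘ k, fun A hA => ⟨_, hk A hA, ?_⟩⟩
    simp only [Atom.map, Atom.subst, Atom.mk.injEq, heq_eq_eq, true_and]
    funext l
    cases A.args l <;> rfl
  | lin p head =>
    rintro _ ⟨⟨p', t⟩, ht, hf⟩
    cases hf
    obtain ⟨k, hk⟩ := h t ht
    refine ⟨e ∘ k, fun A hA => ⟨_, hk A hA, ?_⟩⟩
    simp only [Atom.map, Atom.subst, Atom.mk.injEq, heq_eq_eq, true_and]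
    funext l
    cases h : A.args l <;> simp

/-- Universality: a homomorphism from `D` into a model extends to the chase. -/
theorem exists_chase_hom {X : Type w} [Nonempty X] {B : Instance ar X} (hB : ∀ ρ ∈ rs, ρ.Holds B)
    (g : Δ → X) (hg : ∀ f ∈ D, f.map g ∈ B) :
    ∃ k : ChaseTerm Δ → X, (∀ d, k (.base d) = g d) ∧ ∀ f ∈ chase rs D, f.map k ∈ B := by
  classical
  -- A choice of witnesses for the existential variables, whenever the body is satisfied.
  have hc : ∀ ρ ∈ rs, ∀ x, ∃ h : ℕ → X, ∀ s ss head, ρ = .conj s ss head →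
      (∀ s' ∈ s :: ss, s'.At B x) → ∀ A ∈ head, A.subst (fun o => o.elim x h) ∈ B := by
    intro ρ hρ x
    by_cases hx : ∃ s ss head, ρ = .conj s ss head ∧ ∀ s' ∈ s :: ss, s'.At B x
    · obtain ⟨s, ss, head, rfl, hx⟩ := hx
      obtain ⟨h, hh⟩ := hB _ hρ x hx
      refine ⟨h, fun _ _ _ he _ => ?_⟩
      cases he
      exact hh
    · exact ⟨fun _ => x, fun s ss head he hs => absurd ⟨s, ss, head, he, hs⟩ hx⟩
  have hl : ∀ ρ ∈ rs, ∀ n (t : Fin n → X), ∃ h : ℕ → X, ∀ p head (e : ar p = n), ρ = .lin p head →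
      (⟨p, t ∘ Fin.cast e⟩ : Atom ar X) ∈ B →
        ∀ A ∈ head, A.subst (Sum.elim (t ∘ Fin.cast e) h) ∈ B := by
    intro ρ hρ n t
    by_cases hx : ∃ (p : P) (head : List (Atom ar (Fin (ar p) ⊕ ℕ))) (e : ar p = n),
        ρ = .lin p head ∧ (⟨p, t ∘ Fin.cast e⟩ : Atom ar X) ∈ B
    · obtain ⟨p, head, e, rfl, hx⟩ := hx
      obtain ⟨h, hh⟩ := hB _ hρ _ hx
      refine ⟨h, fun _ _ _ he _ => ?_⟩
      cases he
      exact hh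
    · exact ⟨fun _ => Classical.arbitrary X,
        fun p head e he hs => absurd ⟨p, head, e, he, hs⟩ hx⟩
  choose! hc hc' using hc
  choose! hl hl' using hl
  let w : ℕ → ℕ → (n : ℕ) → (Fin n → X) → X := fun r v n t =>
    match rs[r]? with
    | some (.conj s ss head) =>
      if hn : 0 < n then hc (.conj s ss head) (t ⟨0, hn⟩) v else Classical.arbitrary X
    | some (.lin p head) => hl (.lin p head) n t v
    | none => Classical.arbitrary X
  let k : ChaseTerm Δ → X := fun x => ChaseTerm.rec g (fun r v n _ ih => w r v n ih) x
  refine ⟨k, fun _ => rfl, fun f hf => ?_⟩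
  refine chase_induction (motive := fun f => f.map k ∈ B) hg ?_ ?_ hf
  · intro r s ss head hr x hx A hA
    have hx' : ∀ s' ∈ s :: ss, s'.At B (k x) := fun s' hs' => by
      obtain ⟨t, ht, rfl⟩ := hx s' hs'
      exact ⟨_, ht.2, rfl⟩
    convert hc' _ (List.mem_of_getElem? hr) (k x) s ss head rfl hx' A hA using 1
    simp only [Atom.map, Atom.subst, Atom.mk.injEq, heq_eq_eq, true_and]
    funext l
    cases A.args l with
    | none => rfl
    | some v => simp [k, w, hr]
  · intro r p head hr t _ ht A hA
    convert hl' _ (List.mem_of_getElem? hr) _ (k ∘ t) p head rfl rfl ht A hA using 1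
    simp only [Atom.map, Atom.subst, Atom.mk.injEq, heq_eq_eq, true_and]
    funext l
    cases A.args l with
    | inl i => rfl
    | inr v =>
      simp only [Sum.elim_inr, k, w, hr]
      rfl

end Chase

/-! ### Bounded support of chase facts -/

section Support
variable {P : Type u} {ar : P → ℕ} {Δ : Type w} {rs : List (TGD ar)} {D D₀ : Set (Atom ar Δ)}
  {Q : Set P}

/-- `D₀` accounts for the presence of `x` in the chase of `D`: if `x` is a null, the chase of `D₀`
satisfies the body whose application creates `x`; if `x` is an element of `Δ`, it occurs in `D₀` at
each place, with symbol in `Q`, at which it occurs in `D`. -/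
structure AccountsFor (rs : List (TGD ar)) (Q : Set P) (D D₀ : Set (Atom ar Δ))
    (x : ChaseTerm Δ) : Prop where
  base : ∀ d, x = .base d → ∀ s : Place ar, s.1 ∈ Q → s.At D d → s.At D₀ d
  conj : ∀ (r v : ℕ) (y : ChaseTerm Δ), x = .null r v 1 (fun _ => y) →
    ∀ (s : Place ar) (ss : List (Place ar)) (head : List (Atom ar (Option ℕ))),
      rs[r]? = some (.conj s ss head) → ∀ s' ∈ s :: ss, s'.At (chase rs D₀) y
  lin : ∀ (r v : ℕ) (p : P) (t : Fin (ar p) → ChaseTerm Δ), x = .null r v (ar p) t →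
    ∀ head : List (Atom ar (Fin (ar p) ⊕ ℕ)),
      rs[r]? = some (.lin p head) → ⟨p, t⟩ ∈ chase rs D₀

theorem Place.At.base {s : Place ar} {d : Δ} : s.At D d → s.At (chase rs D) (.base d) := by
  rintro ⟨t, ht, rfl⟩
  exact ⟨_, base_mem_chase ht, rfl⟩

/-- The places at which `x` occurs in the chase are determined by any part of the data that accounts
for `x`: a fact containing `x` arises, through facts that all contain `x`, from the data or from the
creation of `x`. -/
theorem AccountsFor.at_of_mem_chase (hQ : ∀ ρ ∈ rs, ρ.BodyIn Q) {x : ChaseTerm Δ}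
    (hx : AccountsFor rs Q D D₀ x) {f : Atom ar (ChaseTerm Δ)} (hf : f ∈ chase rs D) :
    ∀ i : Fin (ar f.pred), f.args i = x → f.pred ∈ Q →
      Place.At ⟨f.pred, i⟩ (chase rs D₀) x := by
  refine chase_induction (motive := fun f => ∀ i : Fin (ar f.pred), f.args i = x → f.pred ∈ Q →
    Place.At ⟨f.pred, i⟩ (chase rs D₀) x) ?_ ?_ ?_ hf
  · rintro f hf i rfl hp
    exact (hx.base _ rfl ⟨f.pred, i⟩ hp ⟨f.args, hf, rfl⟩).base
  · intro r s ss head hr y hy A hA i hi _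
    have hi' : (A.args i).elim y (fun v => .null r v 1 fun _ => y) = x := hi
    have hb := hQ _ (List.mem_of_getElem? hr)
    refine ⟨_, conj_mem_chase (x := y) hr (fun s' hs' => ?_) hA, hi⟩
    cases hAi : A.args i with
    | none =>
      rw [hAi] at hi'
      obtain rfl : y = x := hi'
      obtain ⟨t, ht, hty⟩ := hy s' hs'
      exact ht.2 s'.2 hty (hb s' hs')
    | some v =>
      rw [hAi] at hi'
      exact hx.conj r v y hi'.symm s ss head hr s' hs'
  · intro r p head hr t _ ih A hA i hi _
    have hi' : Sum.elim t (fun v => .null r v (ar p) t) (A.args i) = x := hi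
    cases hAi : A.args i with
    | inl j =>
      rw [hAi] at hi'
      obtain ⟨t', ht', hj⟩ := ih j hi' (hQ _ (List.mem_of_getElem? hr))
      refine ⟨_, lin_mem_chase hr ht' hA, ?_⟩
      show Sum.elim t' _ (A.args i) = x
      rw [hAi]
      exact hj
    | inr v =>
      rw [hAi] at hi'
      exact ⟨_, lin_mem_chase hr (hx.lin r v p t hi'.symm head hr) hA, hi⟩

/-- A null that occurs in the chase has been created there. -/
theorem accountsFor_null {r v n : ℕ} {u : Fin n → ChaseTerm Δ} {f : Atom ar (ChaseTerm Δ)}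
    (hf : f ∈ chase rs D₀) {i : Fin (ar f.pred)} (hi : f.args i = .null r v n u) :
    AccountsFor rs Q D D₀ (.null r v n u) := by
  generalize hx : ChaseTerm.null r v n u = x at *
  refine chase_induction (motive := fun f => ∀ i, f.args i = x → AccountsFor rs Q D D₀ x)
    ?_ ?_ ?_ hf i hi
  · rintro f - i rfl
    cases hx
  · intro r' s ss head hr y hy A hA i hi
    have hi' : (A.args i).elim y (fun v => .null r' v 1 fun _ => y) = x := hi
    cases hAi : A.args i with
    | none =>
      rw [hAi] at hi'
      obtain ⟨t, ht, hty⟩ := hy s List.mem_cons_self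
      exact ht.2 s.2 (hty.trans hi')
    | some w =>
      rw [hAi] at hi'
      subst hi'
      refine ⟨nofun, fun r₁ v₁ y₁ h₁ s₁ ss₁ head₁ hr₁ s' hs' => ?_,
        fun r₁ v₁ p₁ t₁ h₁ head₁ hr₁ => ?_⟩
      · simp only [Option.elim_some, ChaseTerm.null.injEq, heq_eq_eq, true_and] at h₁
        obtain ⟨rfl, rfl, h₁⟩ := h₁
        cases hr.symm.trans hr₁
        rw [← congrFun h₁ 0]
        exact (hy s' hs').mono fun _ h => h.1
      · simp only [Option.elim_some, ChaseTerm.null.injEq] at h₁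
        obtain ⟨rfl, -⟩ := h₁
        cases hr.symm.trans hr₁
  · intro r' p head hr t ht ih A hA i hi
    have hi' : Sum.elim t (fun v => .null r' v (ar p) t) (A.args i) = x := hi
    cases hAi : A.args i with
    | inl j =>
      rw [hAi] at hi'
      exact ih j hi'
    | inr w =>
      rw [hAi] at hi'
      subst hi'
      refine ⟨nofun, fun r₁ v₁ y₁ h₁ s₁ ss₁ head₁ hr₁ s' hs' => ?_,
        fun r₁ v₁ p₁ t₁ h₁ head₁ hr₁ => ?_⟩
      · simp only [Sum.elim_inr, ChaseTerm.null.injEq] at h₁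
        obtain ⟨rfl, -⟩ := h₁
        cases hr.symm.trans hr₁
      · simp only [Sum.elim_inr, ChaseTerm.null.injEq] at h₁
        obtain ⟨rfl, rfl, -, h₁⟩ := h₁
        cases hr.symm.trans hr₁
        rwa [← eq_of_heq h₁]

/-- One witness for each place suffices to account for an element of `Δ`. -/
theorem exists_accountsFor_base (L : Finset (Place ar)) (hL : ∀ s : Place ar, s.1 ∈ Q ↔ s ∈ L)
    (d : Δ) : ∃ D₀ : Finset (Atom ar Δ), ↑D₀ ⊆ D ∧ D₀.card ≤ L.card ∧ (∀ g ∈ D₀, g.pred ∈ Q) ∧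
      AccountsFor rs Q D D₀ (.base d) := by
  classical
  have hw : ∀ s : Place ar, ∃ t : Fin (ar s.1) → Δ, s.At D d → ⟨s.1, t⟩ ∈ D ∧ t s.2 = d := by
    intro s
    by_cases hs : s.At D d
    · exact hs.imp fun t ht _ => ht
    · exact ⟨fun _ => d, fun h => absurd h hs⟩
  choose t ht using hw
  refine ⟨(L.filter (·.At D d)).image fun s => ⟨s.1, t s⟩, ?_,
    Finset.card_image_le.trans (Finset.card_filter_le _ _), ?_, ?_, nofun, nofun⟩
  · intro g hg
    simp only [Finset.coe_image, Finset.coe_filter, Set.mem_image, Set.mem_ofPred_eq] at hg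
    obtain ⟨s, hs, rfl⟩ := hg
    exact (ht s hs.2).1
  · intro g hg
    simp only [Finset.mem_image, Finset.mem_filter] at hg
    obtain ⟨s, hs, rfl⟩ := hg
    exact (hL s).2 hs.1
  · intro d' hd s hs hsD
    cases hd
    refine ⟨t s, ?_, (ht s hsD).2⟩
    simp only [Finset.coe_image, Finset.coe_filter, Set.mem_image, Set.mem_ofPred_eq]
    exact ⟨s, ⟨(hL s).1 hs, hsD⟩, rfl⟩

/-- Every fact of the chase is derived from boundedly many facts of the data. -/
theorem exists_support (L : Finset (Place ar)) (hL : ∀ s : Place ar, s.1 ∈ Q ↔ s ∈ L)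
    (hQ : ∀ ρ ∈ rs, ρ.BodyIn Q) {f : Atom ar (ChaseTerm Δ)} (hf : f ∈ chase rs D) :
    ∃ D₀ : Finset (Atom ar Δ), ↑D₀ ⊆ D ∧ D₀.card ≤ L.card + 1 ∧
      (∀ g ∈ D₀, g.pred ∈ Q ∨ g.pred = f.pred) ∧ f ∈ chase rs D₀ := by
  refine chase_induction (motive := fun f => ∃ D₀ : Finset (Atom ar Δ), ↑D₀ ⊆ D ∧
    D₀.card ≤ L.card + 1 ∧ (∀ g ∈ D₀, g.pred ∈ Q ∨ g.pred = f.pred) ∧ f ∈ chase rs D₀) ?_ ?_ ?_ hf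
  · exact fun f hf => ⟨{f}, by simpa using hf, by simp, by simp [Atom.map],
      base_mem_chase (by simp)⟩
  · intro r s ss head hr x hx A hA
    have hb := hQ _ (List.mem_of_getElem? hr)
    -- A part of the data that accounts for `x` derives the whole body, hence the head.
    suffices h : ∃ D₀ : Finset (Atom ar Δ), ↑D₀ ⊆ D ∧ D₀.card ≤ L.card + 1 ∧
        (∀ g ∈ D₀, g.pred ∈ Q) ∧ AccountsFor rs Q D D₀ x by
      obtain ⟨D₀, h1, h2, h3, h4⟩ := h
      refine ⟨D₀, h1, h2, fun g hg => .inl (h3 g hg), conj_mem_chase hr (fun s' hs' => ?_) hA⟩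
      obtain ⟨t, ht, htx⟩ := hx s' hs'
      exact h4.at_of_mem_chase hQ ht.1 s'.2 htx (hb s' hs')
    cases x with
    | base d =>
      obtain ⟨D₀, h1, h2, h3⟩ := exists_accountsFor_base (rs := rs) (D := D) L hL d
      exact ⟨D₀, h1, h2.trans (Nat.le_succ _), h3⟩
    | null r' v n t' =>
      obtain ⟨t, ⟨-, D₀, h1, h2, h3, h4⟩, htx⟩ := hx s List.mem_cons_self
      exact ⟨D₀, h1, h2, fun g hg => (h3 g hg).elim id fun h => h ▸ hb s List.mem_cons_self,
        accountsFor_null h4 htx⟩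
  · rintro r p head hr t - ⟨D₀, h1, h2, h3, h4⟩ A hA
    exact ⟨D₀, h1, h2, fun g hg => .inl ((h3 g hg).elim id fun h =>
      h ▸ (hQ _ (List.mem_of_getElem? hr) : p ∈ Q)), lin_mem_chase hr h4 hA⟩

end Support

/-! ### Rewriting into a union of conjunctive queries -/

section Rewriting
variable {P : Type u} {ar : P → ℕ} {Δ : Type w} {rs : List (TGD ar)} {q : BCQ ar Δ}

/-- The query holds in every model of the dependencies that contains `D`. -/
def Entails (rs : List (TGD ar)) (D : Instance ar Δ) (q : BCQ ar Δ) : Prop :=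
  ∀ B : Instance ar Δ, D ⊆ B → (∀ ρ ∈ rs, ρ.Holds B) → q.HoldsIn B

/-- The constants of a query. -/
def BCQ.consts (q : BCQ ar Δ) : Set Δ := {c | ∃ A ∈ q, ∃ i, A.args i = .const c}

theorem Term.eval_comp {X Y Z : Type w} {ι : X → Y} (h : ℕ → Y) (k : Y → Z) (t : Term X) :
    k (t.eval ι h) = t.eval (k ∘ ι) (k ∘ h) := by
  cases t <;> rfl

theorem Atom.map_map {X Y Z : Type w} (k : Y → Z) (g : X → Y) (A : Atom ar X) :
    (A.map g).map k = A.map (k ∘ g) := rfl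

theorem Atom.map_congr {X Y : Type w} {f g : X → Y} {A : Atom ar X}
    (h : ∀ i, f (A.args i) = g (A.args i)) : A.map f = A.map g := by
  simp only [Atom.map, h]

theorem BCQ.map_eval_congr {X : Type w} {ι ι' : Δ → X} (h : ℕ → X) (hι : ∀ c ∈ q.consts, ι c = ι' c)
    {A : Atom ar (Term Δ)} (hA : A ∈ q) : A.map (Term.eval ι h) = A.map (Term.eval ι' h) :=
  Atom.map_congr fun i => by
    cases ht : A.args i with
    | var n => rfl
    | const c => exact hι c ⟨A, hA, i, ht⟩

theorem finite_args {I : Set (Atom ar Δ)} (hI : I.Finite) : {x | ∃ f ∈ I, ∃ i, f.args i = x}.Finite := by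
  have : {x | ∃ f ∈ I, ∃ i, f.args i = x} = ⋃ f ∈ I, Set.range f.args := by
    ext x
    simp
  rw [this]
  exact hI.biUnion fun f _ => Set.finite_range _

theorem BCQ.finite_consts (q : BCQ ar Δ) : q.consts.Finite := by
  have h := (finite_args (I := {A | A ∈ q}) q.finite_toSet).preimage
    (f := Term.const) (fun _ _ _ _ h => Term.const.inj h)
  exact h.subset fun c ⟨A, hA, hc⟩ => ⟨A, hA, hc⟩

/-- The chase, embedded into `Δ`, is a model. So an entailed query holds in the chase. -/
theorem Entails.exists_hom_chase [Infinite Δ] {D : Instance ar Δ} (hD : D.Finite)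
    (hq : Entails rs D q) :
    ∃ h : ℕ → ChaseTerm Δ, ∀ A ∈ q, A.map (Term.eval .base h) ∈ chase rs D := by
  obtain ⟨e, he, hfix⟩ := ChaseTerm.exists_injective ((finite_args hD).union q.finite_consts)
  obtain ⟨h, hh⟩ := hq (Atom.map e '' chase rs D) (fun f hf => ⟨_, base_mem_chase hf, by
    rw [Atom.map_map]
    exact (Atom.map_congr (g := id) fun i => hfix _ (.inl ⟨f, hf, i, rfl⟩))⟩)
    fun ρ hρ => (TGD.holds_chase hρ).image he
  have : Nonempty (ChaseTerm Δ) := ⟨.base (h 0)⟩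
  refine ⟨Function.invFun e ∘ h, fun A hA => ?_⟩
  obtain ⟨f, hf, hfA⟩ := hh A hA
  convert hf using 1
  have h1 := congrArg (Atom.map (Function.invFun e)) hfA
  rw [Atom.map_map, Atom.map_map, Function.invFun_comp he] at h1
  refine Eq.trans ?_ h1.symm
  refine Atom.map_congr fun i => ?_
  cases ht : A.args i with
  | var n => rfl
  | const c =>
    have hc := hfix c (.inr ⟨A, hA, i, ht⟩)
    show _ = Function.invFun e c
    conv_rhs => rw [← hc]
    exact (Function.leftInverse_invFun he _).symm

/-- A query that holds in the chase of `D₀` is entailed by every homomorphic image of `D₀`. -/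
theorem entails_of_hom_chase {D₀ D : Instance ar Δ} {h : ℕ → ChaseTerm Δ}
    (hh : ∀ A ∈ q, A.map (Term.eval .base h) ∈ chase rs D₀) {g : Δ → Δ}
    (hgc : ∀ c ∈ q.consts, g c = c) (hg : ∀ f ∈ D₀, f.map g ∈ D) [Nonempty Δ] : Entails rs D q := by
  intro B hDB hB
  obtain ⟨k, hk, hkB⟩ := exists_chase_hom hB g fun f hf => hDB (hg f hf)
  refine ⟨k ∘ h, fun A hA => ?_⟩
  convert hkB _ (hh A hA) using 1
  rw [Atom.map_map, BCQ.map_eval_congr (ι := id) (ι' := k ∘ .base) _ (fun c hc => ?_) hA]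
  · exact Atom.map_congr fun i => (Term.eval_comp h k _).symm
  · simp [hk, hgc c hc]

theorem finite_atoms {X : Type w} {Ps : Set P} (hPs : Ps.Finite) {Ts : Set X} (hTs : Ts.Finite) :
    {A : Atom ar X | A.pred ∈ Ps ∧ ∀ i, A.args i ∈ Ts}.Finite := by
  refine (hPs.biUnion fun p _ => (Set.Finite.pi' fun _ : Fin (ar p) => hTs).image
    fun t => (⟨p, t⟩ : Atom ar X)).subset ?_
  rintro ⟨p, t⟩ ⟨hp, ht⟩
  exact Set.mem_biUnion hp ⟨t, ht, rfl⟩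

/-- If a query is entailed by `D`, then it is so by a part of `D` whose size is bounded
independently of `D`. -/
theorem exists_bound_support [Infinite Δ] {Q : Set P} (hQf : Q.Finite) (hQ : ∀ ρ ∈ rs, ρ.BodyIn Q)
    (q : BCQ ar Δ) : ∃ M : ℕ, ∀ D : Instance ar Δ, D.Finite → Entails rs D q →
      ∃ D₀ : Finset (Atom ar Δ), ↑D₀ ⊆ D ∧ D₀.card ≤ M ∧
        (∀ g ∈ D₀, g.pred ∈ Q ∨ ∃ A ∈ q, g.pred = A.pred) ∧
        ∃ h : ℕ → ChaseTerm Δ, ∀ A ∈ q, A.map (Term.eval .base h) ∈ chase rs (D₀ : Set _) := by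
  classical
  let L : Finset (Place ar) := hQf.toFinset.sigma fun _ => Finset.univ
  have hL : ∀ s : Place ar, s.1 ∈ Q ↔ s ∈ L := fun s => by simp [L]
  refine ⟨q.toFinset.card * (L.card + 1), fun D hD hq => ?_⟩
  obtain ⟨h, hh⟩ := hq.exists_hom_chase hD
  choose! D₀ h1 h2 h3 h4 using fun A hA => exists_support L hL hQ (hh A hA)
  refine ⟨q.toFinset.biUnion D₀, ?_, Finset.card_biUnion_le_card_mul _ _ _ fun A hA =>
    h2 A (List.mem_toFinset.1 hA), ?_, h, fun A hA => ?_⟩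
  · simpa using h1
  · intro g hg
    obtain ⟨A, hA, hgA⟩ := Finset.mem_biUnion.1 hg
    have hA := List.mem_toFinset.1 hA
    exact (h3 A hA g hgA).imp_right fun h => ⟨A, hA, h⟩
  · exact chase_mono (Finset.coe_subset.2 (Finset.subset_biUnion_of_mem D₀
      (List.mem_toFinset.2 hA))) (h4 A hA)

/-- First-order rewritability: over finite instances, entailment of `q` amounts to one of finitely
many conjunctive queries. These are all the queries below a bounded size that imply the
entailment of `q`. -/
theorem exists_rewriting [Infinite Δ] {Q : Set P} (hQf : Q.Finite) (hQ : ∀ ρ ∈ rs, ρ.BodyIn Q)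
    (q : BCQ ar Δ) : ∃ U : List (BCQ ar Δ),
      (∀ l ∈ U, ∀ A ∈ l, A.pred ∈ Q ∨ ∃ A' ∈ q, A.pred = A'.pred) ∧
      ∀ D : Instance ar Δ, D.Finite → (Entails rs D q ↔ ∃ l ∈ U, l.HoldsIn D) := by
  classical
  obtain ⟨M, hM⟩ := exists_bound_support hQf hQ q
  let Ps : Set P := Q ∪ {p | ∃ A ∈ q, p = A.pred}
  have hPs : Ps.Finite := hQf.union <|
    ((q.finite_toSet).image Atom.pred).subset fun p ⟨A, hA, h⟩ => ⟨A, hA, h.symm⟩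
  obtain ⟨a, ha⟩ := (hPs.image ar).bddAbove
  let Ts : Set (Term Δ) := Term.var '' {n | n < M * a} ∪ Term.const '' q.consts
  have hTs : Ts.Finite := ((Set.finite_lt_nat _).image _).union (q.finite_consts.image _)
  let atoms := (finite_atoms (ar := ar) hPs hTs).toFinset.toList
  refine ⟨atoms.sublists.filter fun l => ∀ D : Instance ar Δ, D.Finite → BCQ.HoldsIn l D →
    Entails rs D q, ?_, fun D hD => ⟨fun hq => ?_, ?_⟩⟩
  · intro l hl A hA
    have hA' := (List.mem_sublists.1 (List.mem_filter.1 hl).1).subset hA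
    simp only [atoms, Finset.mem_toList, Set.Finite.mem_toFinset] at hA'
    exact hA'.1
  · obtain ⟨D₀, h1, h2, h3, h, hh⟩ := hM D hD hq
    -- The small support, read as a query: its elements other than the constants of `q` are
    -- replaced by variables.
    let s : Finset Δ := D₀.biUnion fun f => Finset.univ.image f.args
    have hs : s.card ≤ M * a := by
      refine (Finset.card_biUnion_le_card_mul _ _ a fun f hf => ?_).trans
        (Nat.mul_le_mul_right a h2)
      refine Finset.card_image_le.trans ?_
      rw [Finset.card_univ, Fintype.card_fin]
      exact ha ⟨_, h3 f hf, rfl⟩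
    let ν : Δ → ℕ := fun x => if hx : x ∈ s then s.equivFin ⟨x, hx⟩ else 0
    have hν : ∀ x ∈ s, ν x < M * a := fun x hx => by
      simp only [ν, dif_pos hx]
      exact (s.equivFin _).2.trans_le hs
    let τ : Δ → Term Δ := fun x => if x ∈ q.consts then .const x else .var (ν x)
    have hmem : ∀ f ∈ D₀, ∀ i, f.args i ∈ s := fun f hf i =>
      Finset.mem_biUnion.2 ⟨f, hf, Finset.mem_image_of_mem _ (Finset.mem_univ _)⟩
    have hatoms : ∀ f ∈ D₀, f.map τ ∈ atoms := fun f hf => by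
      simp only [atoms, Finset.mem_toList, Set.Finite.mem_toFinset]
      refine ⟨h3 f hf, fun i => ?_⟩
      by_cases hc : f.args i ∈ q.consts
      · exact .inr ⟨_, hc, by simp [Atom.map, τ, hc]⟩
      · exact .inl ⟨_, hν _ (hmem f hf i), by simp [Atom.map, τ, hc]⟩
    refine ⟨atoms.filter fun A => ∃ f ∈ D₀, f.map τ = A,
      List.mem_filter.2 ⟨List.mem_sublists.2 List.filter_sublist, ?_⟩, ?_⟩
    · simp only [decide_eq_true_eq]
      rintro D' hD' ⟨k, hk⟩
      refine entails_of_hom_chase hh (g := fun x => (τ x).eval id k) (fun c hc => ?_) fun f hf => ?_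
      · simp [τ, hc, Term.eval]
      · exact hk _ (List.mem_filter.2 ⟨hatoms f hf, by simpa using ⟨f, hf, rfl⟩⟩)
    · -- The support itself is the image of this query under the inverse of the numbering.
      let k : ℕ → Δ := fun n => if hn : n < s.card then s.equivFin.symm ⟨n, hn⟩ else
        Classical.arbitrary Δ
      refine ⟨k, fun A hA => ?_⟩
      obtain ⟨f, hf, rfl⟩ := of_decide_eq_true (List.mem_filter.1 hA).2
      convert h1 hf using 1
      rw [Atom.map_map]
      refine Atom.map_congr (g := id) fun i => ?_
      by_cases hc : f.args i ∈ q.consts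
      · simp [τ, hc, Term.eval]
      · simp [τ, hc, Term.eval, k, ν, hmem f hf i]
  · rintro ⟨l, hl, hlD⟩
    exact of_decide_eq_true (List.mem_filter.1 hl).2 D hD hlD

end Rewriting

/-! ### From the rewriting to a Datalog program -/

section Programs
variable {P E : Type u} {ar : P → ℕ} {arE : E → ℕ} {Δ : Type w}

/-- The program with one rule `goal :- l` for each query `l` of `U`, where `emb` reads atoms as atoms
over the extensional predicates. -/
def unionProgram (emb : Atom ar (Term Δ) → Atom (DPred.arity arE) (Term Δ)) (U : List (BCQ ar Δ)) :
    Program arE Δ :=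
  U.map fun l => ⟨⟨IDB.goal, fun i => Fin.elim0 i⟩, l.map emb⟩

variable {emb : Atom ar (Term Δ) → Atom (DPred.arity arE) (Term Δ)} {U : List (BCQ ar Δ)}

theorem unionProgram_isNonrecursive (h : ∀ A, ∃ e, (emb A).pred = .edb e) :
    (unionProgram emb U).IsNonrecursive where
  safe r hr i := by
    obtain ⟨l, -, rfl⟩ := List.mem_map.1 hr
    exact Fin.elim0 i
  acyclic p hp := by
    obtain ⟨p', ⟨r, hr, -, A, hA, hp'⟩, -⟩ := Relation.TransGen.head'_iff.1 hp
    obtain ⟨l, -, rfl⟩ := List.mem_map.1 hr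
    obtain ⟨A', -, rfl⟩ := List.mem_map.1 hA
    obtain ⟨e, he⟩ := h A'
    exact nomatch he.symm.trans hp'

theorem unionProgram_arityLE {X : Set E} {n : ℕ}
    (h : ∀ l ∈ U, ∀ A ∈ l, (emb A).pred.arity arE ≤ n ∨ ∃ e ∈ X, (emb A).pred = .edb e) :
    (unionProgram emb U).ArityLE X n := by
  intro r hr
  obtain ⟨l, hl, rfl⟩ := List.mem_map.1 hr
  refine ⟨Nat.zero_le _, fun A hA => ?_⟩
  obtain ⟨A', hA', rfl⟩ := List.mem_map.1 hA
  exact h l hl A' hA'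

/-- The program accepts iff one of the queries holds, provided that the extensional facts over the
symbols of the queries are those of `I`. The domain `X` of the facts may be larger than `Δ`. -/
theorem unionProgram_accepts_iff {X : Type w} {ι : Δ → X} {κ : X → Δ} (hκ : ∀ d, κ (ι d) = d)
    {F : Atom arE X → Prop} {I : Instance ar Δ}
    (h : ∀ A (k : ℕ → X), (unionProgram emb U).Derives ι F ((emb A).map (Term.eval ι k)) ↔
      ∃ f ∈ I, A.map (Term.eval ι k) = f.map ι) :
    (unionProgram emb U).Accepts ι F ↔ ∃ l ∈ U, l.HoldsIn I := by
  constructor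
  · intro hacc
    unfold Program.Accepts at hacc
    generalize hg : (⟨.idb IDB.goal, fun i => Fin.elim0 i⟩ : Atom (DPred.arity arE) X) = g at hacc
    cases hacc with
    | edb f hf => cases congrArg Atom.pred hg
    | rule r hr k hb =>
      obtain ⟨l, hl, rfl⟩ := List.mem_map.1 hr
      refine ⟨l, hl, κ ∘ k, fun A hA => ?_⟩
      obtain ⟨f, hf, hAf⟩ := (h A k).1 (hb _ (List.mem_map_of_mem hA))
      convert hf using 1
      have h1 := congrArg (Atom.map κ) hAf
      rw [Atom.map_map, Atom.map_map] at h1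
      refine Eq.trans (Atom.map_congr fun i => ?_)
        (h1.trans (Atom.map_congr (g := id) fun i => hκ _))
      cases A.args i with
      | var n => rfl
      | const c => exact (hκ c).symm
  · rintro ⟨l, hl, k, hk⟩
    have hd := Program.Derives.rule (ar := arE) (ι := ι) (F := F) _
      (List.mem_map_of_mem hl : _ ∈ unionProgram emb U) (ι ∘ k) fun A' hA' => by
        obtain ⟨A, hA, rfl⟩ := List.mem_map.1 hA'
        refine (h A _).2 ⟨_, hk A hA, ?_⟩
        rw [Atom.map_map]
        refine Atom.map_congr fun i => ?_
        cases A.args i <;> rfl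
    have ht : ∀ t t' : Fin 0 → X, t = t' := fun _ _ => Subsingleton.elim _ _
    exact (congrArg (fun t => (unionProgram emb U).Derives ι F ⟨.idb IDB.goal, t⟩) (ht _ _)).mp hd

theorem Program.derives_edb_iff {X : Type w} {Pr : Program arE Δ} {ι : Δ → X}
    {F : Atom arE X → Prop} (e : E) (t : Fin (arE e) → X) :
    Pr.Derives ι F ⟨.edb e, t⟩ ↔ F ⟨e, t⟩ := by
  constructor
  · intro h
    generalize hg : (⟨.edb e, t⟩ : Atom (DPred.arity arE) X) = g at h
    cases h with
    | edb f hf => cases f; cases hg; exact hf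
    | rule r hr k hb => cases congrArg Atom.pred hg
  · exact fun h => .edb ⟨e, t⟩ h

theorem Database.full_rel_iff {D : Database ar Δ} (p : P) (t : Fin (ar p) → Δ) :
    D.Full ⟨.rel p, t⟩ ↔ (⟨p, t⟩ : Atom ar Δ) ∈ D.facts := by
  constructor
  · intro h
    generalize hg : (⟨.rel p, t⟩ : Atom (DBSym.arity ar) Δ) = g at h
    cases h with
    | rel f hf => cases f; cases hg; exact hf
    | _ => cases congrArg Atom.pred hg
  · exact fun h => .rel ⟨p, t⟩ h

theorem Database.numFull_rel_iff {D : Database ar Δ} {N : ℕ} (p : P)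
    (t : Fin (ar p) → Δ ⊕ Fin (N + 1)) :
    D.NumFull N ⟨.db (.rel p), t⟩ ↔ ∃ f ∈ D.facts, ⟨p, t⟩ = f.map Sum.inl := by
  constructor
  · intro h
    generalize hg : (⟨.db (.rel p), t⟩ : Atom (NumSym.arity ar) (Δ ⊕ Fin (N + 1))) = g at h
    cases h with
    | rel f hf => cases f; cases hg; exact ⟨_, hf, rfl⟩
    | _ => cases congrArg Atom.pred hg
  · rintro ⟨f, hf, h⟩
    cases f
    cases h
    exact .rel _ hf

end Programs

/-! ### Certain answers of the DL-Lite family -/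

theorem arity_le_posArity {S : Signature.{u}} {Sp : List (PosAxiom S)} {p : S.Sym}
    (hp : p ∈ Sp.flatMap PosAxiom.syms) : S.arity p ≤ posArity Sp := by
  unfold posArity
  generalize Sp.flatMap PosAxiom.syms = l at hp
  induction l with
  | nil => simp at hp
  | cons p' l ih =>
    rw [List.map_cons, List.foldr_cons]
    rcases List.mem_cons.1 hp with rfl | hp
    · exact le_max_left _ _
    · exact (ih hp).trans (le_max_right _ _)

/-- First-order rewritability of query answering with positive assertions. -/
theorem exists_rewriting_certainlyHolds {S : Signature.{u}} {Δ : Type w} [Infinite Δ]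
    (Sp : List (PosAxiom S)) (q : BCQ S.arity Δ) : ∃ U : List (BCQ S.arity Δ),
      (∀ l ∈ U, ∀ A ∈ l, S.arity A.pred ≤ posArity Sp ∨ ∃ A' ∈ q, A.pred = A'.pred) ∧
      ∀ D : Database S.arity Δ, CertainlyHolds D Sp q ↔ ∃ l ∈ U, l.HoldsIn D.facts := by
  choose ρ hρ hρ' using fun σ : PosAxiom S => σ.exists_tgd Δ
  obtain ⟨U, hU, hU'⟩ := exists_rewriting (rs := Sp.map ρ)
    (List.finite_toSet (Sp.flatMap PosAxiom.syms)) (fun τ hτ => by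
      obtain ⟨σ, hσ, rfl⟩ := List.mem_map.1 hτ
      have hsub : ∀ p ∈ σ.syms, p ∈ Sp.flatMap PosAxiom.syms := fun p hp =>
        List.mem_flatMap.2 ⟨σ, hσ, hp⟩
      have hb := hρ σ
      cases h : ρ σ with
      | conj s ss head => rw [h] at hb; exact fun s' hs' => hsub _ (hb s' hs')
      | lin p head => rw [h] at hb; exact hsub _ hb) q
  refine ⟨U, fun l hl A hA => (hU l hl A hA).imp_left arity_le_posArity, fun D => ?_⟩
  rw [← hU' D.facts D.finite]
  simp only [CertainlyHolds, Entails, List.mem_map, forall_exists_index, and_imp,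
    forall_apply_eq_imp_iff₂, hρ']

theorem mainTheorem3 (v : Variant) :
    ∃ (γ : MvPolynomial (Fin 2) ℕ) (C : ℕ),
      (∀ m n : ℕ, max m n ≤ MvPolynomial.eval ![m, n] γ) ∧
      ∀ (S : Signature.{u}) (Δ : Type w) [Infinite Δ] (T : TBox S), v.Admits T →
        ∀ q : BCQ S.arity Δ,
          (∃ P : Program (NumSym.arity S.arity) Δ,
            P.IsNonrecursive ∧
            P.ArityLE {e | ∃ A ∈ q, e = .db (.rel A.pred)} (max (posArity T.pos + 1) 3) ∧
            ∀ N : ℕ, MvPolynomial.eval ![posSize T.pos, q.size] γ ≤ N →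
              ∀ D : Database S.arity Δ, CertainlyHolds D T.pos q ↔ D.NumModels N P) ∧
          (∃ P : Program (DBSym.arity S.arity) Δ,
            P.IsNonrecursive ∧
            P.ArityLE {e | ∃ A ∈ q, e = .rel A.pred}
              (C * max (posArity T.pos + 1) 3 * Nat.log 2 (posSize T.pos + q.size)) ∧
            ∀ D : Database S.arity Δ, CertainlyHolds D T.pos q ↔ D.Models P) := by
  refine ⟨.X 0 + .X 1, 1, fun m n => by simp, fun S Δ _ T _ q => ?_⟩
  obtain ⟨U, hU, hU'⟩ := exists_rewriting_certainlyHolds T.pos q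
  refine ⟨⟨unionProgram (fun A => ⟨.edb (.db (.rel A.pred)), A.args⟩) U,
      unionProgram_isNonrecursive fun A => ⟨_, rfl⟩, unionProgram_arityLE fun l hl A hA => ?_,
      fun N _ D => ?_⟩,
    ⟨unionProgram (fun A => ⟨.edb (.rel A.pred), A.args⟩) U,
      unionProgram_isNonrecursive fun A => ⟨_, rfl⟩, unionProgram_arityLE fun l hl A hA => ?_,
      fun D => ?_⟩⟩
  · refine (hU l hl A hA).imp (fun h => ?_) fun ⟨A', hA', h⟩ => ⟨_, ⟨A', hA', by rw [h]⟩, rfl⟩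
    exact (h.trans (Nat.le_succ _)).trans (le_max_left _ _)
  · rw [hU' D]
    refine (unionProgram_accepts_iff (κ := Sum.elim id fun _ => D.zero) (fun _ => rfl)
      fun A k => ?_).symm
    exact (Program.derives_edb_iff _ _).trans (Database.numFull_rel_iff _ _)
  · refine (hU l hl A hA).imp (fun h => ?_) fun ⟨A', hA', h⟩ => ⟨_, ⟨A', hA', by rw [h]⟩, rfl⟩
    -- Both sizes are positive, so that the logarithm is at least `1`.
    have hlog : 1 ≤ Nat.log 2 (posSize T.pos + q.size) :=
      Nat.log_pos one_lt_two (by unfold posSize BCQ.size; omega)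
    refine ((h.trans (Nat.le_succ _)).trans (le_max_left _ 3)).trans ?_
    rw [one_mul]
    exact Nat.le_mul_of_pos_right _ hlog
  · rw [hU' D]
    refine (unionProgram_accepts_iff (κ := id) (fun _ => rfl) fun A k => ?_).symm
    refine (Program.derives_edb_iff _ _).trans ((Database.full_rel_iff _ _).trans ?_)
    exact ⟨fun h => ⟨_, h, rfl⟩, fun ⟨f, hf, h⟩ => (congrArg (· ∈ D.facts) h).mpr hf⟩
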